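/- Let $M\cong\mathbb Z^d$ be a lattice with dual lattice $N$, and let $\Lambda\subset M$ be a finitely generated sub-semigroup (containing $0$) that generates $M$ as a group and whose cone $\sigma^\vee:=\mathbb R_{\ge 0}\Lambda\subset M_{\mathbb R}$ is strictly convex (for instance $\Lambda=\sigma^\vee\cap M$ for a strictly convex rational cone $\sigma^\vee$ of dimension $d$). Let $\sigma\subset N_{\mathbb R}$ be the cone dual to $\sigma^\vee$, let $Z^\Lambda$ be the affine toric variety of $\Lambda$, whose closed points are the semigroup homomorphisms $\Lambda\to(\mathbb C,\cdot)$, and let $A=\mathbb C\{\Lambda\}$ be the ring of germs of holomorphic functions on $Z^\Lambda$ at its origin, i.e. of the series $\sum_{\alpha\in\Lambda}c_\alpha X^\alpha$ that converge absolutely in a neighbourhood of the origin. For an ideal $\mathcal I$ of $A$, $a\in A$ and an ideal $\mathcal J$ of $A$ put $\nu_{\mathcal I}(a)=\sup\{n\mid a\in\mathcal I^n\}$, $\nu_{\mathcal I}(\mathcal J)=\sup\{n\mid \mathcal J\subset\mathcal I^n\}$, $$\overline\nu_{\mathcal I}(a)=\lim_{k\to\infty}\frac{\nu_{\mathcal I}(a^k)}{k},\qquad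 \overline\nu_{\mathcal I}(\mathcal J)=\lim_{k\to\infty}\frac{\nu_{\mathcal I}(\mathcal J^k)}{k}\qquad\text{in }[0,\infty].$$ Let $\mathcal I=(X^u\mid u\in I)$ and $\mathcal J=(X^u\mid u\in J)$ be proper monomial ideals of $A$, with $\mathcal I\neq 0$, and let $\phi=\sum c_\alpha X^\alpha\in A$. Let $\mathcal N(\mathcal I)$, $\mathcal N(\mathcal J)$ and $\mathcal N(\phi)$ be the convex hulls of $I+\sigma^\vee$, of $J+\sigma^\vee$ and of $\{\alpha\mid c_\alpha\ne0\}+\sigma^\vee$, and let $\mathrm{ord}_{\mathcal I},\mathrm{ord}_{\mathcal J},\mathrm{ord}_{\mathcal N(\phi)}$ be their support functions $\nu\mapsto\inf_{\omega}\langle\nu,\omega\rangle$ on $\sigma$ (equal to $+\infty$ for an empty polyhedron). Let $\Sigma(\mathcal I)$ be the dual fan of $\mathcal N(\mathcal I)$, which consists of the cones $\{\eta\in\sigma\mid\langle\eta,v\rangle=\mathrm{ord}_{\mathcal I}(\eta)\ \forall v\in\mathcal F\}$ for the nonempty faces $\mathcal F$ of $\mathcal N(\mathcal I)$. Let $\{n_k\}_{k\in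 K(\mathcal I)}$ be the set of the primitive vectors $n$ of $N$ lying on the one-dimensional cones of $\Sigma(\mathcal I)$ such that, if $\tau$ is the face of $\sigma$ that contains $n$ in its relative interior, the torus orbit $\mathrm{orb}_\tau=\{x\in Z^\Lambda\mid x(m)\neq0\Leftrightarrow m\in\tau^\perp\}$ is contained in the zero locus of $\mathcal I$ in $Z^\Lambda$. (These vectors correspond to the irreducible components of the exceptional divisor of the normalized blow-up of $\mathcal I$.) Then the limits defining $\overline\nu_{\mathcal I}(\phi)$ and $\overline\nu_{\mathcal I}(\mathcal J)$ exist and $$\overline\nu_{\mathcal I}(\phi)=\min_{k\in K(\mathcal I)}\frac{\mathrm{ord}_{\mathcal N(\phi)}(n_k)}{\mathrm{ord}_{\mathcal I}(n_k)},\qquad \overline\nu_{\mathcal I}(\mathcal J)=\min_{k\in K(\mathcal I)}\frac{\mathrm{ord}_{\mathcal J}(n_k)}{\mathrm{ord}_{\mathcal I}(n_k)}.$$ -/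

import Mathlib

noncomputable section

namespace AsymptoticOrder

open Filter Topology
open scoped ENNReal

/-! ### The asymptotic order of Lejeune-Jalabert and Teissier -/

section Order

variable {A : Type*} [CommRing A]

/-- The order `ν_I(a) = sup {n | a ∈ I ^ n}` with respect to the `I`-adic filtration. -/
def nu (I : Ideal A) (a : A) : ℕ∞ := ⨆ n ∈ {n : ℕ | a ∈ I ^ n}, (n : ℕ∞)

/-- The order `ν_I(J) = sup {n | J ⊆ I ^ n}` of an ideal. -/
def nuIdeal (I J : Ideal A) : ℕ∞ := ⨆ n ∈ {n : ℕ | J ≤ I ^ n}, (n : ℕ∞)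

/-- The quotients `ν_I(a ^ k) / k`. -/
def nuQuot (I : Ideal A) (a : A) (k : ℕ) : ℝ≥0∞ := (nu I (a ^ k) : ℝ≥0∞) / (k : ℝ≥0∞)

/-- The quotients `ν_I(J ^ k) / k`. -/
def nuIdealQuot (I J : Ideal A) (k : ℕ) : ℝ≥0∞ := (nuIdeal I (J ^ k) : ℝ≥0∞) / (k : ℝ≥0∞)

/-- The asymptotic order `lim_k ν_I(a ^ k) / k`, an element of `[0, ∞]`. -/
def nuBar (I : Ideal A) (a : A) : ℝ≥0∞ := limUnder atTop (nuQuot I a)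

/-- The asymptotic order `lim_k ν_I(J ^ k) / k`, an element of `[0, ∞]`. -/
def nuBarIdeal (I J : Ideal A) : ℝ≥0∞ := limUnder atTop (nuIdealQuot I J)

end Order

/-! ### Lattices, cones and semigroups

The lattices `M` and `N` are both `ℤ ^ d`, in dual bases; `M_ℝ` and `N_ℝ` are both `ℝ ^ d`, and the
pairing is the dot product. -/

/-- The inclusion of the lattice `ℤ ^ d` in `ℝ ^ d`. -/
def toReal {d : ℕ} (m : Fin d → ℤ) : Fin d → ℝ := fun i => (m i : ℝ)

/-- The support function `ν ↦ inf_{ω ∈ P} ⟨ν, ω⟩` of `P`, with the value `∞` if `P` is empty. -/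
def supportFn {d : ℕ} (P : Set (Fin d → ℝ)) (ν : Fin d → ℝ) : EReal := ⨅ ω ∈ P, ((ν ⬝ᵥ ω : ℝ) : EReal)

/-- `F` is a (nonempty) face of the polyhedron `P`. -/
def IsFace {d : ℕ} (P F : Set (Fin d → ℝ)) : Prop := F.Nonempty ∧ IsExposed ℝ P F

/-- `n` is a primitive vector of the lattice `N = ℤ ^ d`. -/
def IsPrimitive {d : ℕ} (n : Fin d → ℤ) : Prop :=
  ∀ (k : ℤ) (m : Fin d → ℤ), n = k • m → IsUnit k

/-- A sub-semigroup of finite type (with zero) `Λ` of the lattice `M = ℤ ^ d` which generates `M` as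
a group and whose cone `ℝ_{≥ 0} Λ` is strictly convex, that is, contains no line. -/
structure ToricSemigroup (d : ℕ) where
  carrier : AddSubmonoid (Fin d → ℤ)
  fg : carrier.FG
  closure_eq_top : AddSubgroup.closure (carrier : Set (Fin d → ℤ)) = ⊤
  eq_zero_of_neg_mem : ∀ w ∈ PointedCone.hull ℝ (toReal '' (carrier : Set (Fin d → ℤ))),
    -w ∈ PointedCone.hull ℝ (toReal '' (carrier : Set (Fin d → ℤ))) → w = 0

namespace ToricSemigroup

variable {d : ℕ} (Λ : ToricSemigroup d)

/-- The cone `σ^∨ = ℝ_{≥ 0} Λ` in `M_ℝ`. -/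
def dualCone : Set (Fin d → ℝ) :=
  (PointedCone.hull ℝ (toReal '' (Λ.carrier : Set (Fin d → ℤ))) : Set (Fin d → ℝ))

/-- The cone `σ` in `N_ℝ` whose dual cone is `σ^∨`. -/
def cone : Set (Fin d → ℝ) := {ν | ∀ w ∈ Λ.dualCone, 0 ≤ ν ⬝ᵥ w}

/-- The semigroup `Λ` as a type of exponents. -/
def Exp : Type := Λ.carrier

instance : AddCommMonoid Λ.Exp := inferInstanceAs (AddCommMonoid Λ.carrier)

instance : IsCancelAdd Λ.Exp := inferInstanceAs (IsCancelAdd Λ.carrier)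

variable {Λ} in
/-- The exponent `m ∈ Λ` as a vector of `M = ℤ ^ d`. -/
def Exp.vec (m : Λ.Exp) : Fin d → ℤ := Subtype.val (p := fun x => x ∈ Λ.carrier) m

theorem Exp.vec_injective : Function.Injective (Exp.vec (Λ := Λ)) := Subtype.val_injective

@[simp] theorem Exp.vec_zero : (0 : Λ.Exp).vec = 0 := rfl

@[simp] theorem Exp.vec_add (a b : Λ.Exp) : (a + b).vec = a.vec + b.vec := rfl

theorem Exp.toReal_vec_mem (a : Λ.Exp) : toReal a.vec ∈ Λ.dualCone :=
  Submodule.subset_span ⟨_, Subtype.property (p := fun x => x ∈ Λ.carrier) a, rfl⟩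

theorem Exp.eq_zero_of_add_eq_zero {a b : Λ.Exp} (h : a + b = 0) : a = 0 := by
  have hb : toReal b.vec = -toReal a.vec := by
    have h' : a.vec + b.vec = 0 := by rw [← Exp.vec_add, h, Exp.vec_zero]
    funext i
    have := congrFun h' i
    simp only [Pi.add_apply, Pi.zero_apply] at this
    have h2 : b.vec i = -a.vec i := by omega
    simp [toReal, h2]
  have h0 := Λ.eq_zero_of_neg_mem _ a.toReal_vec_mem (hb ▸ b.toReal_vec_mem)
  apply Exp.vec_injective
  funext i
  simpa [toReal] using congrFun h0 i

/-- The divisibility order of monomials: `a ≤ b` when `b ∈ a + Λ`. -/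
instance : PartialOrder Λ.Exp where
  le a b := ∃ c, b = a + c
  le_refl a := ⟨0, by simp⟩
  le_trans a b c := by
    rintro ⟨x, rfl⟩ ⟨y, rfl⟩
    exact ⟨x + y, by rw [add_assoc]⟩
  le_antisymm a b := by
    rintro ⟨x, hx⟩ ⟨y, hy⟩
    have h : x + y = 0 := by
      apply add_left_cancel (a := a)
      rw [← add_assoc, ← hx, ← hy, add_zero]
    rw [hx, Exp.eq_zero_of_add_eq_zero Λ h, add_zero]

theorem Exp.le_def (a b : Λ.Exp) : a ≤ b ↔ ∃ c, b = a + c := Iff.rfl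

instance : IsOrderedCancelAddMonoid Λ.Exp where
  add_le_add_left a b := by
    rintro ⟨x, rfl⟩ c
    exact ⟨x, by abel⟩
  le_of_add_le_add_left a b c := by
    rintro ⟨x, hx⟩
    exact ⟨x, add_left_cancel (a := a) (by rw [hx, add_assoc])⟩

/-- Every set of exponents is partially well ordered, so that a Hahn series with exponents in `Λ` is
an arbitrary family of coefficients: `HahnSeries Λ.Exp ℂ` is the ring `ℂ[[Λ]]`. -/
theorem Exp.isPWO (s : Set Λ.Exp) : s.IsPWO := by
  obtain ⟨t, ht⟩ := Λ.fg
  have hmem : ∀ i : t, (i : Fin d → ℤ) ∈ Λ.carrier := fun i =>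
    ht ▸ AddSubmonoid.subset_closure i.2
  let g : t → Λ.Exp := fun i => (⟨i, hmem i⟩ : Λ.carrier)
  let f : (t → ℕ) → Λ.Exp := fun n => ∑ i, n i • g i
  have hf : Monotone f := by
    intro a b hab
    refine ⟨f (fun i => b i - a i), ?_⟩
    simp only [f, ← Finset.sum_add_distrib, ← add_smul]
    exact Finset.sum_congr rfl fun i _ => by rw [Nat.add_sub_cancel' (hab i)]
  have hadd : ∀ a b, f (a + b) = f a + f b := by
    intro a b
    simp [f, ← Finset.sum_add_distrib, add_smul]
  have hsurj : ∀ m (hm : m ∈ AddSubmonoid.closure (t : Set (Fin d → ℤ))),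
      ∃ n, (f n).vec = m := by
    intro m hm
    induction hm using AddSubmonoid.closure_induction with
    | mem x hx =>
      refine ⟨Pi.single ⟨x, hx⟩ 1, ?_⟩
      have : f (Pi.single ⟨x, hx⟩ 1) = g ⟨x, hx⟩ := by
        simp only [f]
        rw [Finset.sum_eq_single ⟨x, hx⟩]
        · simp
        · intro b _ hb
          simp [Pi.single_eq_of_ne hb]
        · simp
      rw [this]
      rfl
    | zero => exact ⟨0, by simp [f]⟩
    | add x y _ _ hx hy =>
      obtain ⟨a, rfl⟩ := hx
      obtain ⟨b, rfl⟩ := hy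
      exact ⟨a + b, by rw [hadd, Exp.vec_add]⟩
  have huniv : s ⊆ f '' Set.univ := by
    intro m _
    obtain ⟨n, hn⟩ := hsurj m.vec (ht ▸ Subtype.property (p := fun x => x ∈ Λ.carrier) m)
    exact ⟨n, trivial, Exp.vec_injective Λ hn⟩
  exact ((Set.isPWO_of_wellQuasiOrderedLE _).image_of_monotone hf).mono huniv

/-! ### The affine toric variety and its germs of functions -/

/-- The closed points of the affine toric variety `Z^Λ`, that is, the semigroup homomorphisms
`Λ → (ℂ, ·)` (with the topology of pointwise convergence, which is the classical topology). -/
def Point : Type := {x : Λ.Exp → ℂ // x 0 = 1 ∧ ∀ a b, x (a + b) = x a * x b}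

instance : TopologicalSpace Λ.Point :=
  inferInstanceAs (TopologicalSpace {x : Λ.Exp → ℂ // x 0 = 1 ∧ ∀ a b, x (a + b) = x a * x b})

variable {Λ} in
/-- The value at the point `x` of the monomial with exponent `m`. -/
def Point.eval (x : Λ.Point) (m : Λ.Exp) : ℂ :=
  Subtype.val (p := fun x : Λ.Exp → ℂ => x 0 = 1 ∧ ∀ a b, x (a + b) = x a * x b) x m

theorem Point.eval_zero (x : Λ.Point) : x.eval 0 = 1 := x.2.1

theorem Point.eval_add (x : Λ.Point) (a b : Λ.Exp) : x.eval (a + b) = x.eval a * x.eval b :=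
  x.2.2 a b

open Classical in
/-- The origin of `Z^Λ`, where every monomial with nonzero exponent vanishes. -/
def origin : Λ.Point := ⟨fun m => if m = 0 then 1 else 0, by simp, by
  intro a b
  by_cases ha : a = 0
  · simp [ha]
  · have : a + b ≠ 0 := fun h => ha (Exp.eq_zero_of_add_eq_zero Λ h)
    simp [ha, this]⟩

theorem summable_mul {x : Λ.Point} {f g : HahnSeries Λ.Exp ℂ}
    (hf : Summable fun m => f.coeff m * x.eval m) (hg : Summable fun m => g.coeff m * x.eval m) :
    Summable fun m => (f * g).coeff m * x.eval m := by
  have h := summable_mul_of_summable_norm hf.norm hg.norm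
  have h' := ((Equiv.sigmaFiberEquiv (fun p : Λ.Exp × Λ.Exp => p.1 + p.2)).summable_iff.mpr h).sigma
  refine h'.congr fun m => ?_
  rw [HahnSeries.coeff_mul, Finset.sum_mul]
  let F : Λ.Exp × Λ.Exp → ℂ := fun p =>
    (f.coeff p.1 * x.eval p.1) * (g.coeff p.2 * x.eval p.2)
  have key : (∑' p : {p : Λ.Exp × Λ.Exp | p.1 + p.2 = m}, F p) =
      ∑ p ∈ Finset.antidiagonal f.isPWO_support g.isPWO_support m,
        f.coeff p.1 * g.coeff p.2 * x.eval m := by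
    rw [tsum_subtype, tsum_eq_sum (s := Finset.antidiagonal f.isPWO_support g.isPWO_support m)]
    · refine Finset.sum_congr rfl fun p hp => ?_
      have hp' : p.1 + p.2 = m := (Finset.mem_antidiagonal.mp hp).2.2
      rw [Set.indicator_of_mem (show p ∈ {p : Λ.Exp × Λ.Exp | p.1 + p.2 = m} from hp'), ← hp',
        Point.eval_add]
      simp only [F]
      ring
    · intro p hp
      by_cases hpm : p.1 + p.2 = m
      · have : f.coeff p.1 = 0 ∨ g.coeff p.2 = 0 := by
          by_contra hc
          push Not at hc
          exact hp (Finset.mem_antidiagonal.mpr ⟨hc.1, hc.2, hpm⟩)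
        rw [Set.indicator_of_mem (show p ∈ {p : Λ.Exp × Λ.Exp | p.1 + p.2 = m} from hpm)]
        rcases this with h0 | h0 <;> simp [F, h0]
      · exact Set.indicator_of_notMem (s := {p : Λ.Exp × Λ.Exp | p.1 + p.2 = m}) hpm F
  exact key

/-- The ring `ℂ{Λ}` of germs of holomorphic functions of `Z^Λ` at the origin: the series in
`ℂ[[Λ]]` that converge (absolutely) at every point of a neighbourhood of the origin of `Z^Λ`. -/
def germs : Subring (HahnSeries Λ.Exp ℂ) where
  carrier := {f | ∀ᶠ x in 𝓝 Λ.origin, Summable fun m => f.coeff m * x.eval m}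
  mul_mem' hf hg := by
    filter_upwards [hf, hg] with x hx hy using Λ.summable_mul hx hy
  one_mem' := by
    refine Eventually.of_forall fun x => summable_of_hasFiniteSupport ?_
    refine (Set.finite_singleton (0 : Λ.Exp)).subset fun m hm => ?_
    by_contra h
    exact hm (by simp [HahnSeries.coeff_one, show m ≠ 0 from h])
  add_mem' hf hg := by
    filter_upwards [hf, hg] with x hx hy
    simpa only [HahnSeries.coeff_add, add_mul] using hx.add hy
  zero_mem' := Eventually.of_forall fun x => by simp
  neg_mem' hf := by
    filter_upwards [hf] with x hx
    simpa only [HahnSeries.coeff_neg, neg_mul] using hx.neg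

/-- The monomial `X ^ u` in `ℂ{Λ}`. -/
def monomial (u : Λ.Exp) : Λ.germs := ⟨HahnSeries.single u 1, by
  refine Eventually.of_forall fun x => summable_of_hasFiniteSupport ?_
  refine (Set.finite_singleton u).subset fun m hm => ?_
  by_contra h
  exact hm (by simp [HahnSeries.coeff_single_of_ne (show m ≠ u from h)])⟩

/-- The monomial ideal of `ℂ{Λ}` generated by the monomials `X ^ u`, for `u ∈ I`. -/
def monomialIdeal (I : Set Λ.Exp) : Ideal Λ.germs := Ideal.span (Λ.monomial '' I)

/-! ### Newton polyhedra and the dual fan -/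

/-- The convex hull of the Minkowski sum `S + σ^∨`, for a set of exponents `S`. It is the Newton
polyhedron of the monomial ideal generated by the monomials with exponents in `S`. -/
def newton (S : Set Λ.Exp) : Set (Fin d → ℝ) :=
  convexHull ℝ (⋃ α ∈ S, {v | ∃ w ∈ Λ.dualCone, v = toReal α.vec + w})

/-- The Newton polyhedron of a germ `φ = ∑ c_α X ^ α`, defined by the `α` with `c_α ≠ 0`. -/
def newtonGerm (φ : Λ.germs) : Set (Fin d → ℝ) := Λ.newton {α | (φ : HahnSeries Λ.Exp ℂ).coeff α ≠ 0}

/-- The cone `σ(F)` of the vectors `η ∈ σ` whose minimum on the polyhedron `P` is attained at every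
point of `F`. -/
def faceCone (P F : Set (Fin d → ℝ)) : Set (Fin d → ℝ) :=
  {η | η ∈ Λ.cone ∧ ∀ v ∈ F, ((η ⬝ᵥ v : ℝ) : EReal) = supportFn P η}

/-- The dual fan `Σ(I)` of the Newton polyhedron of the monomial ideal defined by `I`: the fan of
the normalized blow up. -/
def dualFan (I : Set Λ.Exp) : Set (Set (Fin d → ℝ)) :=
  {ρ | ∃ F, IsFace (Λ.newton I) F ∧ ρ = Λ.faceCone (Λ.newton I) F}

/-- The orbit of the torus action on `Z^Λ` that corresponds to the face `τ` of `σ`. -/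
def orb (τ : Set (Fin d → ℝ)) : Set Λ.Point :=
  {x | ∀ m : Λ.Exp, x.eval m ≠ 0 ↔ ∀ ν ∈ τ, ν ⬝ᵥ toReal m.vec = 0}

/-- The zero locus in `Z^Λ` of the monomial ideal defined by `I`. -/
def zeroLocus (I : Set Λ.Exp) : Set Λ.Point := {x | ∀ u ∈ I, x.eval u = 0}

/-- The set of the vectors `n_k`, `k ∈ K(I)`, that correspond to the irreducible components of the
exceptional divisor of the normalized blow up of the monomial ideal defined by `I`: the primitive
vectors `n` of the edges `ρ` of the dual fan such that, for the face `τ` of `σ` which contains `n`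
in its relative interior, the orbit of `τ` is contained in the zero locus of the ideal. -/
def excVectors (I : Set Λ.Exp) : Set (Fin d → ℤ) :=
  {n | IsPrimitive n ∧
    (∃ ρ ∈ Λ.dualFan I, Module.finrank ℝ (Submodule.span ℝ ρ) = 1 ∧ toReal n ∈ ρ) ∧
    ∃ τ, IsFace Λ.cone τ ∧ toReal n ∈ intrinsicInterior ℝ τ ∧ Λ.orb τ ⊆ Λ.zeroLocus I}

end ToricSemigroup

end AsymptoticOrder

end

open AsymptoticOrder Filter Topology

/-!
Both formulas compare the powers of a monomial ideal with its Newton polyhedron.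

*Upper bound.* Each `n = n_k` defines a monomial valuation: the germs with all exponents of weight
at least `r` form an ideal (`weightIdeal`), and `𝓘 ^ m` lies in the one for `r = m · ord_𝓘 n`. The
condition on the orbits says precisely that `ord_𝓘 n > 0`, hence `ord_𝓘 n ≥ 1`
(`one_le_weight_of_mem_excVectors`). As the valuation of `φ ^ k` is `k` times that of `φ`
(`exists_coeff_pow_ne_zero`), the order of `φ ^ k` is at most `k · ord_φ n / ord_𝓘 n`.

*Lower bound.* Let `c` be the minimum of the quotients. An exponent `β` of `φ ^ k` satisfies `⟨n,
β⟩ ≥ k c · ord_𝓘 n` for the facet normals `n` that are positive on the ideal, and `⟨n, β⟩ ≥ 0` for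
the other facet normals, so `β` lies in `k c · 𝓝(𝓘)`. That the facet normals suffice is Farkas'
lemma (`exists_nonneg_sum_of_dual`) applied to the cone over the Newton polyhedron, together with
the existence of extremal rays (`exists_extremal_ray`) and their rationality (`exists_int_ker`);
`exists_excVector_of_extremal` recognizes these rays in the dual fan. Now `β` is a real
combination of the generators of the ideal and of `Λ`, the generators of the ideal having total
coefficient `k c`. Rounding down leaves a remainder that takes finitely many values in `ℤ ^ d`,
and as `Λ` need not be saturated it has to be corrected by a bounded number of generators; that a
bounded number is enough is Dickson's lemma (`exists_artinRees_const`, `exists_rounding_const`).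
Hence `X ^ β ∈ 𝓘 ^ m` as soon as `m ≤ k c - K`, with `K` independent of `k` and `β`
(`exists_finset_excVectors`).

To pass from monomials to germs one divides a convergent series by a monomial. The terms of the
quotient are compared with those of the given series at a point of the torus close to the origin,
where the monomial does not vanish; so the quotient converges again (`quotSeries_mem`), and a germ
belongs to an ideal that contains all its monomials (`mem_of_monomial_mem`).

The order of the `k`-th power thus stays at a bounded distance below `k c`, whence the limit
(`exists_limit_isLeast`). Finitely many `n_k` already suffice for the lower bound, and the upper
bound holds for all of them, so that the limit is the least of all the quotients.
-/

open scoped ENNReal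

namespace AsymptoticOrder

/-! ### Polyhedral cones -/

/-- **Farkas' lemma** for finitely many vectors of `ℝ ^ n`. -/
theorem exists_nonneg_sum_of_dual {n : ℕ} {ι : Type*} (s : Finset ι) (a : ι → Fin n → ℝ)
    (b : Fin n → ℝ) (h : ∀ f : Fin n → ℝ, (∀ i ∈ s, 0 ≤ f ⬝ᵥ a i) → 0 ≤ f ⬝ᵥ b) :
    ∃ c : ι → ℝ, (∀ i, 0 ≤ c i) ∧ b = ∑ i ∈ s, c i • a i := by
  classical
  induction s using Finset.induction_on generalizing a b with
  | empty =>
    have hb : b = 0 := by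
      have h1 := h (-b) (by simp)
      rw [neg_dotProduct] at h1
      have h2 : 0 ≤ b ⬝ᵥ b := Finset.sum_nonneg fun i _ => mul_self_nonneg _
      exact dotProduct_self_eq_zero.mp (le_antisymm (by linarith) h2)
    exact ⟨0, by simp, by simp [hb]⟩
  | insert j s hj ih =>
    by_cases hs : ∀ f : Fin n → ℝ, (∀ i ∈ s, 0 ≤ f ⬝ᵥ a i) → 0 ≤ f ⬝ᵥ b
    · obtain ⟨c, hc, hb⟩ := ih a b hs
      refine ⟨Function.update c j 0, fun i => ?_, ?_⟩
      · by_cases hi : i = j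
        · simp [hi]
        · simp [hi, hc]
      · rw [Finset.sum_insert hj, hb]
        simp only [Function.update_self, zero_smul, zero_add]
        refine Finset.sum_congr rfl fun i hi => ?_
        rw [Function.update_of_ne (ne_of_mem_of_not_mem hi hj)]
    · push Not at hs
      obtain ⟨f, hf, hfb⟩ := hs
      have hfj : f ⬝ᵥ a j < 0 := by
        by_contra hc
        push Not at hc
        refine absurd (h f fun i hi => ?_) (not_le.mpr hfb)
        rcases Finset.mem_insert.mp hi with rfl | hi
        exacts [hc, hf i hi]
      -- project along `a j` onto the kernel of `f`, where the induction hypothesis applies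
      set p : ℝ := -(f ⬝ᵥ a j) with hp
      have hp0 : 0 < p := by linarith
      obtain ⟨c, hc, hb⟩ := ih (fun i => a i + ((f ⬝ᵥ a i) / p) • a j)
          (b + ((f ⬝ᵥ b) / p) • a j) (by
        intro g hg
        have := h (g + ((g ⬝ᵥ a j) / p) • f) (by
          intro i hi
          rcases Finset.mem_insert.mp hi with rfl | hi
          · rw [add_dotProduct, smul_dotProduct, smul_eq_mul]
            have : f ⬝ᵥ a i = -p := by rw [hp, neg_neg]
            rw [this]
            field_simp
            simp
          · have := hg i hi
            rw [dotProduct_add, dotProduct_smul, smul_eq_mul] at this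
            rw [add_dotProduct, smul_dotProduct, smul_eq_mul]
            calc (0 : ℝ) ≤ _ := this
              _ = _ := by ring)
        rw [dotProduct_add, dotProduct_smul, smul_eq_mul]
        rw [add_dotProduct, smul_dotProduct, smul_eq_mul] at this
        calc (0 : ℝ) ≤ _ := this
          _ = _ := by ring)
      refine ⟨Function.update c j ((∑ i ∈ s, c i * ((f ⬝ᵥ a i) / p)) - (f ⬝ᵥ b) / p),
        fun i => ?_, ?_⟩
      · by_cases hi : i = j
        · subst hi
          rw [Function.update_self]
          have h1 : 0 ≤ ∑ k ∈ s, c k * ((f ⬝ᵥ a k) / p) := Finset.sum_nonneg fun k hk =>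
            mul_nonneg (hc k) (div_nonneg (hf k hk) hp0.le)
          have h2 : (f ⬝ᵥ b) / p ≤ 0 := div_nonpos_of_nonpos_of_nonneg hfb.le hp0.le
          linarith
        · simp [hi, hc]
      · refine (eq_sub_of_add_eq hb).trans ?_
        rw [Finset.sum_insert hj, Function.update_self]
        have : ∑ i ∈ s, Function.update c j
            ((∑ i ∈ s, c i * ((f ⬝ᵥ a i) / p)) - (f ⬝ᵥ b) / p) i • a i = ∑ i ∈ s, c i • a i :=
          Finset.sum_congr rfl fun i hi => by
            rw [Function.update_of_ne (ne_of_mem_of_not_mem hi hj)]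
        rw [this]
        simp only [smul_add, Finset.sum_add_distrib, sub_smul, Finset.sum_smul, smul_smul]
        abel

/-- A linear form `b` that is negative somewhere on the pointed polyhedral cone
`{y | ∀ i, 0 ≤ ⟨y, a i⟩}` is negative on one of its extremal rays: on a vector `y` which is
determined up to scaling by the constraints that vanish at `y`. -/
theorem exists_extremal_ray {n : ℕ} {ι : Type*} [Fintype ι] (a : ι → Fin n → ℝ)
    (ha : ∀ y : Fin n → ℝ, (∀ i, y ⬝ᵥ a i = 0) → y = 0) (b y₀ : Fin n → ℝ)
    (h₀ : ∀ i, 0 ≤ y₀ ⬝ᵥ a i) (hb₀ : y₀ ⬝ᵥ b < 0) :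
    ∃ y : Fin n → ℝ, (∀ i, 0 ≤ y ⬝ᵥ a i) ∧ y ⬝ᵥ b < 0 ∧
      ∀ z : Fin n → ℝ, (∀ i, y ⬝ᵥ a i = 0 → z ⬝ᵥ a i = 0) → ∃ c : ℝ, z = c • y := by
  classical
  induction hN : (Finset.univ.filter fun i => y₀ ⬝ᵥ a i ≠ 0).card using Nat.strong_induction_on
    generalizing y₀ with
  | _ N ih =>
  by_cases hext : ∀ z : Fin n → ℝ, (∀ i, y₀ ⬝ᵥ a i = 0 → z ⬝ᵥ a i = 0) → ∃ c : ℝ, z = c • y₀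
  · exact ⟨y₀, h₀, hb₀, hext⟩
  push Not at hext
  obtain ⟨z, hz, hzc⟩ := hext
  -- a direction that keeps `b` and the vanishing constraints, and decreases another constraint
  obtain ⟨w, hw, hwb, hwneg⟩ : ∃ w : Fin n → ℝ, (∀ i, y₀ ⬝ᵥ a i = 0 → w ⬝ᵥ a i = 0) ∧
      w ⬝ᵥ b = 0 ∧ ∃ i, w ⬝ᵥ a i < 0 := by
    set w := z - ((z ⬝ᵥ b) / (y₀ ⬝ᵥ b)) • y₀ with hwdef
    have hw : ∀ i, y₀ ⬝ᵥ a i = 0 → w ⬝ᵥ a i = 0 := fun i hi => by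
      rw [hwdef, sub_dotProduct, smul_dotProduct, hz i hi, hi]; simp
    have hwb : w ⬝ᵥ b = 0 := by
      rw [hwdef, sub_dotProduct, smul_dotProduct, smul_eq_mul, div_mul_cancel₀ _ hb₀.ne, sub_self]
    have hw0 : ∃ i, w ⬝ᵥ a i ≠ 0 := by
      by_contra hc
      push Not at hc
      exact hzc _ (sub_eq_zero.mp (ha w hc))
    obtain ⟨i, hi⟩ := hw0
    rcases lt_or_gt_of_ne hi with hi | hi
    · exact ⟨w, hw, hwb, i, hi⟩
    · exact ⟨-w, fun j hj => by rw [neg_dotProduct, hw j hj, neg_zero],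
        by rw [neg_dotProduct, hwb, neg_zero], i, by rw [neg_dotProduct]; linarith⟩
  obtain ⟨j, hj⟩ := hwneg
  obtain ⟨i₀, hi₀, hmin⟩ := Finset.exists_min_image
    (Finset.univ.filter fun i => w ⬝ᵥ a i < 0) (fun i => (y₀ ⬝ᵥ a i) / (-(w ⬝ᵥ a i)))
    ⟨j, by simpa using hj⟩
  simp only [Finset.mem_filter, Finset.mem_univ, true_and] at hi₀ hmin
  set r := (y₀ ⬝ᵥ a i₀) / (-(w ⬝ᵥ a i₀)) with hr
  have hr0 : 0 ≤ r := div_nonneg (h₀ i₀) (by linarith)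
  have hval : ∀ v, (y₀ + r • w) ⬝ᵥ v = y₀ ⬝ᵥ v + r * (w ⬝ᵥ v) := fun v => by
    rw [add_dotProduct, smul_dotProduct, smul_eq_mul]
  refine ih _ ?_ (y₀ + r • w) (fun i => ?_) (by rw [hval, hwb]; simpa using hb₀) rfl
  · rw [← hN]
    refine Finset.card_lt_card (Finset.ssubset_iff_subset_ne.mpr ⟨fun i hi => ?_, fun heq => ?_⟩)
    · simp only [Finset.mem_filter, Finset.mem_univ, true_and] at hi ⊢
      intro hc
      exact hi (by rw [hval, hc, hw i hc]; simp)
    · have hmem : i₀ ∈ Finset.univ.filter fun i => y₀ ⬝ᵥ a i ≠ 0 := by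
        simp only [Finset.mem_filter, Finset.mem_univ, true_and]
        exact fun hc => hi₀.ne (hw i₀ hc)
      rw [← heq] at hmem
      simp only [Finset.mem_filter, Finset.mem_univ, true_and] at hmem
      apply hmem
      rw [hval, hr]
      have := hi₀.ne
      field_simp
      ring
  · rw [hval]
    rcases le_or_gt 0 (w ⬝ᵥ a i) with hi | hi
    · exact add_nonneg (h₀ i) (mul_nonneg hr0 hi)
    · have := hmin i hi
      rw [le_div_iff₀ (by linarith)] at this
      linarith

/-- A homogeneous system of linear equations with integer coefficients that has a nonzero real
solution has a nonzero integer solution. -/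
theorem exists_int_ker {κ ι : Type*} [Fintype κ] [DecidableEq κ] [Fintype ι] (a : ι → κ → ℤ)
    (y : κ → ℝ) (hy : y ≠ 0) (h : ∀ i, y ⬝ᵥ (fun k => (a i k : ℝ)) = 0) :
    ∃ z : κ → ℤ, z ≠ 0 ∧ ∀ i, z ⬝ᵥ a i = 0 := by
  -- pass to the square matrix `Aᵀ A`, which has the same kernel as `A`
  let A : Matrix ι κ ℤ := Matrix.of a
  have hAR : (A.map (Int.castRingHom ℝ)).mulVec y = 0 := by
    funext i
    have := h i
    rw [dotProduct_comm] at this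
    exact this
  have hdet : ((A.transpose * A).map (Int.castRingHom ℝ)).det = 0 := by
    rw [← Matrix.exists_mulVec_eq_zero_iff]
    refine ⟨y, hy, ?_⟩
    rw [Matrix.map_mul, ← Matrix.mulVec_mulVec, hAR, Matrix.mulVec_zero]
  have hdet' : (A.transpose * A).det = 0 := by
    have := RingHom.map_det (Int.castRingHom ℝ) (A.transpose * A)
    rw [RingHom.mapMatrix_apply, hdet] at this
    simpa using this
  obtain ⟨z, hz, hz'⟩ := Matrix.exists_mulVec_eq_zero_iff.mpr hdet'
  refine ⟨z, hz, fun i => ?_⟩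
  have h0 : A.mulVec z ⬝ᵥ A.mulVec z = 0 := by
    have h1 : z ⬝ᵥ (A.transpose * A).mulVec z = 0 := by rw [hz']; simp
    rw [← Matrix.mulVec_mulVec, Matrix.dotProduct_mulVec, Matrix.vecMul_transpose] at h1
    exact h1
  have h2 := congrFun (dotProduct_self_eq_zero.mp h0) i
  rw [dotProduct_comm]
  exact h2

theorem IsPrimitive.ne_zero {n : Fin d → ℤ} (hn : IsPrimitive n) : n ≠ 0 := by
  rintro rfl
  exact not_isUnit_zero (hn 0 0 (by simp))

theorem IsPrimitive.neg {n : Fin d → ℤ} (hn : IsPrimitive n) : IsPrimitive (-n) :=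
  fun k m h => hn k (-m) (by rw [smul_neg, ← h, neg_neg])

theorem exists_primitive {d : ℕ} (z : Fin d → ℤ) (hz : z ≠ 0) :
    ∃ (g : ℤ) (m : Fin d → ℤ), g ≠ 0 ∧ IsPrimitive m ∧ z = g • m := by
  obtain ⟨i, hi⟩ := Function.ne_iff.mp hz
  obtain ⟨m, hm, hg⟩ := Finset.extract_gcd (s := Finset.univ) z ⟨i, Finset.mem_univ i⟩
  refine ⟨Finset.univ.gcd z, m, ?_, ?_, ?_⟩
  · intro h0
    have := hm i (Finset.mem_univ i)
    rw [h0, zero_mul] at this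
    exact hi this
  · rintro k m' rfl
    have : k ∣ Finset.univ.gcd (k • m') := Finset.dvd_gcd fun i _ => ⟨m' i, by simp⟩
    rw [hg] at this
    exact isUnit_of_dvd_one this
  · funext i
    simpa using hm i (Finset.mem_univ i)

/-! ### Exponents and weights -/

/-- In a partially well ordered set finitely many elements lie below all the others. -/
theorem _root_.Set.IsPWO.exists_finset_le {α : Type*} [PartialOrder α] {s : Set α} (hs : s.IsPWO) :
    ∃ F : Finset α, (F : Set α) ⊆ s ∧ ∀ a ∈ s, ∃ b ∈ F, b ≤ a := by
  have hfin : {x | Minimal (· ∈ s) x}.Finite :=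
    (setOfPred_minimal_antichain (· ∈ s)).finite_of_partiallyWellOrderedOn
      (hs.mono fun x hx => hx.prop)
  refine ⟨hfin.toFinset, fun x hx => ?_, fun a ha => ?_⟩
  · exact ((Set.Finite.mem_toFinset hfin).mp (Finset.mem_coe.mp hx)).prop
  · obtain ⟨b, hb, hmin⟩ := hs.exists_le_minimal ha
    exact ⟨b, (Set.Finite.mem_toFinset hfin).mpr hmin, hb⟩

namespace ToricSemigroup

variable {d : ℕ} {Λ : ToricSemigroup d}

theorem toReal_add (a b : Fin d → ℤ) : toReal (a + b) = toReal a + toReal b := by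
  funext i
  simp [toReal]

theorem toReal_dotProduct (n m : Fin d → ℤ) : toReal n ⬝ᵥ toReal m = ((n ⬝ᵥ m : ℤ) : ℝ) := by
  simp [toReal, dotProduct]

theorem toReal_injective : Function.Injective (toReal (d := d)) := fun a b h => by
  funext i
  have := congrFun h i
  simpa [toReal] using this

/-- The exponent of a monomial, as an additive map to `ℤ ^ d`. -/
def Exp.vecHom (Λ : ToricSemigroup d) : Λ.Exp →+ (Fin d → ℤ) where
  toFun := Exp.vec
  map_zero' := rfl
  map_add' _ _ := rfl

/-- The exponent of a monomial, as an additive map to `ℝ ^ d`. -/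
def Exp.realHom (Λ : ToricSemigroup d) : Λ.Exp →+ (Fin d → ℝ) where
  toFun α := toReal α.vec
  map_zero' := by funext i; simp [toReal]
  map_add' a b := toReal_add a.vec b.vec

/-- The weight `⟨η, α⟩` of an exponent `α`. -/
def Exp.weight (Λ : ToricSemigroup d) (η : Fin d → ℝ) : Λ.Exp →+ ℝ where
  toFun α := η ⬝ᵥ toReal α.vec
  map_zero' := by
    have : toReal (0 : Λ.Exp).vec = 0 := (Exp.realHom Λ).map_zero
    rw [this, dotProduct_zero]
  map_add' a b := by rw [Exp.vec_add, toReal_add, dotProduct_add]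

theorem Exp.weight_apply (η : Fin d → ℝ) (α : Λ.Exp) :
    Exp.weight Λ η α = η ⬝ᵥ toReal α.vec := rfl

theorem mem_cone_iff {η : Fin d → ℝ} : η ∈ Λ.cone ↔ ∀ α : Λ.Exp, 0 ≤ Exp.weight Λ η α := by
  refine ⟨fun h α => h _ α.toReal_vec_mem, fun h w hw => ?_⟩
  induction hw using Submodule.span_induction with
  | mem x hx =>
    obtain ⟨m, hm, rfl⟩ := hx
    exact h (show Λ.Exp from (⟨m, hm⟩ : Λ.carrier))
  | zero => simp
  | add x y _ _ hx hy => rw [dotProduct_add]; exact add_nonneg hx hy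
  | smul c x _ hx =>
    have : c • x = (c : ℝ) • x := rfl
    rw [this, dotProduct_smul]
    exact mul_nonneg c.2 hx

theorem Exp.weight_mono {η : Fin d → ℝ} (hη : η ∈ Λ.cone) : Monotone (Exp.weight Λ η) := by
  rintro a b ⟨c, rfl⟩
  rw [map_add]
  linarith [mem_cone_iff.mp hη c]

/-- A weight in `σ` attains its minimum on every nonempty set of exponents. -/
theorem Exp.exists_weight_le {η : Fin d → ℝ} (hη : η ∈ Λ.cone) {S : Set Λ.Exp} (hS : S.Nonempty) :
    ∃ α ∈ S, ∀ β ∈ S, Exp.weight Λ η α ≤ Exp.weight Λ η β := by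
  obtain ⟨F, hF, hle⟩ := (Exp.isPWO Λ S).exists_finset_le
  obtain ⟨s, hs⟩ := hS
  obtain ⟨f, hf, _⟩ := hle s hs
  obtain ⟨α, hα, hmin⟩ := F.exists_min_image (Exp.weight Λ η) ⟨f, hf⟩
  refine ⟨α, hF hα, fun β hβ => ?_⟩
  obtain ⟨b, hb, hbβ⟩ := hle β hβ
  exact (hmin b hb).trans (Exp.weight_mono hη hbβ)

variable (Λ) in
theorem exists_generators : ∃ G : Finset Λ.Exp, 0 ∉ G ∧
    AddSubmonoid.closure (G : Set Λ.Exp) = ⊤ := by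
  classical
  obtain ⟨G, hG⟩ : (⊤ : AddSubmonoid Λ.Exp).FG :=
    AddMonoid.fg_def.mp ((AddMonoid.fg_iff_addSubmonoid_fg Λ.carrier).mpr Λ.fg)
  refine ⟨G.erase 0, by simp, top_le_iff.mp (hG ▸ AddSubmonoid.closure_le.mpr fun g hg => ?_)⟩
  by_cases h0 : g = 0
  · rw [h0]; exact zero_mem _
  · exact AddSubmonoid.subset_closure (by simp [h0, Finset.mem_coe.mp hg])

theorem mem_cone_of_generators {G : Finset Λ.Exp}
    (hG : AddSubmonoid.closure (G : Set Λ.Exp) = ⊤) {η : Fin d → ℝ}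
    (h : ∀ g ∈ G, 0 ≤ Exp.weight Λ η g) : η ∈ Λ.cone := by
  refine mem_cone_iff.mpr fun α => ?_
  have hα : α ∈ AddSubmonoid.closure (G : Set Λ.Exp) := hG ▸ AddSubmonoid.mem_top α
  induction hα using AddSubmonoid.closure_induction with
  | mem x hx => exact h x hx
  | zero => rw [map_zero]
  | add x y _ _ hx hy => rw [map_add]; exact add_nonneg hx hy

/-- As `Λ` generates `ℤ ^ d`, a weight that vanishes on `Λ` is zero. -/
theorem eq_zero_of_weight_eq_zero {η : Fin d → ℝ} (h : ∀ α : Λ.Exp, Exp.weight Λ η α = 0) :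
    η = 0 := by
  have key : ∀ m : Fin d → ℤ, η ⬝ᵥ toReal m = 0 := fun m => by
    have hm : m ∈ AddSubgroup.closure (Λ.carrier : Set (Fin d → ℤ)) :=
      Λ.closure_eq_top ▸ AddSubgroup.mem_top m
    induction hm using AddSubgroup.closure_induction with
    | mem x hx => exact h (show Λ.Exp from (⟨x, hx⟩ : Λ.carrier))
    | zero => simp [toReal, dotProduct]
    | add x y _ _ hx hy => rw [toReal_add, dotProduct_add, hx, hy, add_zero]
    | neg x _ hx =>
      have : toReal (-x) = -toReal x := by funext i; simp [toReal]
      rw [this, dotProduct_neg, hx, neg_zero]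
  funext i
  have h1 := key (Pi.single i 1)
  have h2 : toReal (Pi.single i (1 : ℤ)) = Pi.single i (1 : ℝ) := by
    funext j
    by_cases hj : j = i
    · subst hj; simp [toReal]
    · simp [toReal, hj]
  rw [h2, dotProduct_single_one] at h1
  exact h1

variable (Λ) in
/-- Since `σ^∨` is strictly convex, `σ` has a vector that is positive on `Λ ∖ {0}`. -/
theorem exists_pos_weight : ∃ ξ ∈ Λ.cone, ∀ α : Λ.Exp, α ≠ 0 → 0 < Exp.weight Λ ξ α := by
  classical
  obtain ⟨G, hG0, hG⟩ := exists_generators Λ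
  have hpos : ∀ g : Λ.Exp, ∃ ξ : Fin d → ℝ, g ∈ G → ξ ∈ Λ.cone ∧ 0 < Exp.weight Λ ξ g := by
    intro g
    by_contra hc
    push Not at hc
    have hgG := (hc 0).1
    obtain ⟨c, hc0, hb⟩ := exists_nonneg_sum_of_dual G (fun α => toReal α.vec) (-toReal g.vec)
      (fun f hf => by
        have := (hc f).2 (mem_cone_of_generators hG hf)
        rw [Exp.weight_apply] at this
        rw [dotProduct_neg]
        linarith)
    have hmem : -toReal g.vec ∈
        PointedCone.hull ℝ (toReal '' (Λ.carrier : Set (Fin d → ℤ))) := by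
      rw [hb]
      exact Submodule.sum_mem _ fun i _ =>
        PointedCone.smul_mem _ (hc0 i) (Exp.toReal_vec_mem Λ i)
    have h0 := Λ.eq_zero_of_neg_mem _ (Exp.toReal_vec_mem Λ g) hmem
    have : g = 0 := Exp.vec_injective Λ (by
      funext i
      simpa [toReal] using congrFun h0 i)
    exact hG0 (this ▸ hgG)
  choose ξ hξ using hpos
  have hsum : ∀ α : Λ.Exp, Exp.weight Λ (∑ g ∈ G, ξ g) α = ∑ g ∈ G, Exp.weight Λ (ξ g) α :=
    fun α => by simp only [Exp.weight_apply, sum_dotProduct]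
  have hcone : (∑ g ∈ G, ξ g) ∈ Λ.cone := mem_cone_iff.mpr fun α => by
    rw [hsum]
    exact Finset.sum_nonneg fun g hg => mem_cone_iff.mp (hξ g hg).1 α
  refine ⟨_, hcone, fun α hα => ?_⟩
  have hmem : α ∈ AddSubmonoid.closure (G : Set Λ.Exp) := hG ▸ AddSubmonoid.mem_top α
  have key : α = 0 ∨ 0 < Exp.weight Λ (∑ g ∈ G, ξ g) α := by
    clear hα
    induction hmem using AddSubmonoid.closure_induction with
    | mem x hx =>
      right
      rw [hsum]
      exact Finset.sum_pos' (fun g hg => mem_cone_iff.mp (hξ g hg).1 x) ⟨x, hx, (hξ x hx).2⟩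
    | zero => exact Or.inl rfl
    | add x y _ _ hx hy =>
      rw [map_add]
      rcases hx with rfl | hx
      · simpa using hy
      · exact Or.inr (add_pos_of_pos_of_nonneg hx (mem_cone_iff.mp hcone y))
  exact key.resolve_left hα

/-! ### Rounding real combinations of exponents -/

/-- The combinatorial form of the Artin–Rees lemma: if an exponent `β` equals
`∑ n i • u i + ∑ l j • g j + b` with `b` in `ℤ ^ d`, not necessarily in `Λ`, then it lies in
`∑ n' i • u i + Λ` with a total multiplicity that drops by a bounded amount only. -/
theorem exists_artinRees_const {ι κ : Type*} [Fintype ι] [Fintype κ] (u : ι → Λ.Exp)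
    (g : κ → Λ.Exp) (b : Fin d → ℤ) :
    ∃ K : ℕ, ∀ (n : ι → ℕ) (l : κ → ℕ) (β : Λ.Exp),
      β.vec = ∑ i, n i • (u i).vec + ∑ j, l j • (g j).vec + b →
      ∃ (n' : ι → ℕ) (γ : Λ.Exp), β = ∑ i, n' i • u i + γ ∧ ∑ i, n i ≤ ∑ i, n' i + K := by
  classical
  -- the pairs `(n, l)` that occur have finitely many minimal elements
  let S : Set ((ι → ℕ) × (κ → ℕ)) := {p | ∃ β : Λ.Exp,
    β.vec = ∑ i, p.1 i • (u i).vec + ∑ j, p.2 j • (g j).vec + b}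
  obtain ⟨F, hF, hle⟩ := (Set.isPWO_of_wellQuasiOrderedLE S).exists_finset_le
  refine ⟨F.sup fun p => ∑ i, p.1 i, fun n l β hβ => ?_⟩
  obtain ⟨p, hp, hpn, hpl⟩ := hle (n, l) ⟨β, hβ⟩
  obtain ⟨γ, hγ⟩ := hF hp
  refine ⟨fun i => n i - p.1 i, ∑ j, (l j - p.2 j) • g j + γ, ?_, ?_⟩
  · apply Exp.vec_injective
    have h1 : ∀ α : Λ.Exp, α.vec = Exp.vecHom Λ α := fun _ => rfl
    rw [hβ]
    rw [Exp.vec_add, Exp.vec_add, hγ]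
    simp only [h1, map_sum, map_nsmul]
    have e1 : ∑ i, n i • Exp.vecHom Λ (u i) =
        ∑ i, (n i - p.1 i) • Exp.vecHom Λ (u i) + ∑ i, p.1 i • Exp.vecHom Λ (u i) := by
      rw [← Finset.sum_add_distrib]
      exact Finset.sum_congr rfl fun i _ => by rw [← add_smul, Nat.sub_add_cancel (hpn i)]
    have e2 : ∑ j, l j • Exp.vecHom Λ (g j) =
        ∑ j, (l j - p.2 j) • Exp.vecHom Λ (g j) + ∑ j, p.2 j • Exp.vecHom Λ (g j) := by
      rw [← Finset.sum_add_distrib]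
      exact Finset.sum_congr rfl fun i _ => by rw [← add_smul, Nat.sub_add_cancel (hpl i)]
    rw [e1, e2]
    abel
  · calc ∑ i, n i ≤ ∑ i, ((n i - p.1 i) + p.1 i) :=
          Finset.sum_le_sum fun i _ => by omega
      _ = ∑ i, (n i - p.1 i) + ∑ i, p.1 i := Finset.sum_add_distrib
      _ ≤ _ := Nat.add_le_add_left (Finset.le_sup (f := fun p : (ι → ℕ) × (κ → ℕ) =>
          ∑ i, p.1 i) hp) _

/-- An exponent that is a nonnegative real combination of exponents `u i` and `g j` is a sum of
copies of the `u i` and of an element of `Λ`, the number of copies of the `u i` being at least the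
sum of their real coefficients, up to a constant. -/
theorem exists_rounding_const {ι κ : Type*} [Fintype ι] [Fintype κ] (u : ι → Λ.Exp)
    (g : κ → Λ.Exp) :
    ∃ K : ℕ, ∀ (x : ι → ℝ) (y : κ → ℝ) (β : Λ.Exp), (∀ i, 0 ≤ x i) → (∀ j, 0 ≤ y j) →
      toReal β.vec = ∑ i, x i • toReal (u i).vec + ∑ j, y j • toReal (g j).vec →
      ∃ (n : ι → ℕ) (γ : Λ.Exp), β = ∑ i, n i • u i + γ ∧
        ∑ i, x i ≤ ((∑ i, n i + K : ℕ) : ℝ) := by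
  classical
  choose K hK using exists_artinRees_const u g
  let B : Fin d → ℤ := fun k => ∑ i, |(u i).vec k| + ∑ j, |(g j).vec k|
  refine ⟨(Finset.Icc (-B) B).sup K + Fintype.card ι, fun x y β hx hy hβ => ?_⟩
  -- the remainder of the coordinatewise rounding down lies in the finite box `[-B, B]`
  set b : Fin d → ℤ :=
    β.vec - ∑ i, ⌊x i⌋₊ • (u i).vec - ∑ j, ⌊y j⌋₊ • (g j).vec with hb
  have hfr : ∀ (t : ℝ) (m : ℤ), 0 ≤ t → |(t - (⌊t⌋₊ : ℝ)) * (m : ℝ)| ≤ |(m : ℝ)| := by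
    intro t m ht
    rw [abs_mul]
    refine mul_le_of_le_one_left (abs_nonneg _) (abs_le.mpr ⟨?_, ?_⟩)
    · linarith [Nat.floor_le ht]
    · linarith [Nat.lt_floor_add_one t]
  have hbk : ∀ k, |b k| ≤ B k := fun k => by
    have h1 : ((b k : ℤ) : ℝ) = ∑ i, (x i - (⌊x i⌋₊ : ℝ)) * ((u i).vec k : ℝ) +
        ∑ j, (y j - (⌊y j⌋₊ : ℝ)) * ((g j).vec k : ℝ) := by
      have h2 := congrFun hβ k
      simp only [toReal, Pi.add_apply, Finset.sum_apply, Pi.smul_apply, smul_eq_mul] at h2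
      rw [hb]
      simp only [Pi.sub_apply, Finset.sum_apply, Pi.smul_apply]
      simp only [nsmul_eq_mul]
      push_cast
      rw [h2]
      simp only [sub_mul, Finset.sum_sub_distrib]
      ring
    have h3 : |((b k : ℤ) : ℝ)| ≤ ((B k : ℤ) : ℝ) := by
      rw [h1]
      simp only [B]
      push_cast
      refine (abs_add_le _ _).trans (add_le_add ?_ ?_)
      · exact (Finset.abs_sum_le_sum_abs _ _).trans
          (Finset.sum_le_sum fun i _ => hfr _ _ (hx i))
      · exact (Finset.abs_sum_le_sum_abs _ _).trans
          (Finset.sum_le_sum fun i _ => hfr _ _ (hy i))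
    exact_mod_cast h3
  have hmem : b ∈ Finset.Icc (-B) B := Finset.mem_Icc.mpr
    ⟨fun k => (abs_le.mp (hbk k)).1, fun k => (abs_le.mp (hbk k)).2⟩
  obtain ⟨n, γ, hγ, hn⟩ := hK b (fun i => ⌊x i⌋₊) (fun j => ⌊y j⌋₊) β (by rw [hb]; abel)
  refine ⟨n, γ, hγ, ?_⟩
  have h4 : ∑ i, x i ≤ ((∑ i, ⌊x i⌋₊ + Fintype.card ι : ℕ) : ℝ) := by
    have : ∑ i, x i ≤ ∑ i, ((⌊x i⌋₊ : ℝ) + 1) :=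
      Finset.sum_le_sum fun i _ => (Nat.lt_floor_add_one (x i)).le
    rw [Finset.sum_add_distrib] at this
    simpa using this
  refine h4.trans (Nat.cast_le.mpr ?_)
  have := Finset.le_sup (f := K) hmem
  omega

/-! ### Monomials and convergent series -/

/-- Powers of ideals of `ℂ{Λ}`. The instance is a shortcut for type class search. -/
noncomputable instance : Pow (Ideal Λ.germs) ℕ :=
  (inferInstance : Monoid (Ideal Λ.germs)).toNPow.toPow

theorem mem_germs_iff {f : HahnSeries Λ.Exp ℂ} :
    f ∈ Λ.germs ↔ ∀ᶠ x in 𝓝 Λ.origin, Summable fun m => f.coeff m * x.eval m := Iff.rfl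

theorem monomial_add (a b : Λ.Exp) : Λ.monomial (a + b) = Λ.monomial a * Λ.monomial b :=
  Subtype.ext (by simp [monomial])

theorem monomial_zero : Λ.monomial 0 = 1 := Subtype.ext (by simp [monomial])

theorem monomial_coeff_ne_zero {a b : Λ.Exp}
    (h : (Λ.monomial a : HahnSeries Λ.Exp ℂ).coeff b ≠ 0) : b = a := by
  by_contra hc
  exact h (HahnSeries.coeff_single_of_ne hc)

theorem monomial_coeff_self (a : Λ.Exp) : (Λ.monomial a : HahnSeries Λ.Exp ℂ).coeff a = 1 :=
  HahnSeries.coeff_single_same a 1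

theorem monomial_sum_mem_pow {I : Set Λ.Exp} {ι : Type*} [Fintype ι] (u : ι → Λ.Exp)
    (hu : ∀ i, u i ∈ I) (n : ι → ℕ) :
    Λ.monomial (∑ i, n i • u i) ∈ Λ.monomialIdeal I ^ (∑ i, n i) := by
  let f : Multiplicative Λ.Exp →* Λ.germs :=
    { toFun := fun a => Λ.monomial a.toAdd
      map_one' := monomial_zero
      map_mul' := fun a b => monomial_add a.toAdd b.toAdd }
  have h : Λ.monomial (∑ i, n i • u i) = ∏ i, Λ.monomial (u i) ^ n i := by
    have := map_prod f (fun i => Multiplicative.ofAdd (u i) ^ n i) Finset.univ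
    simp only [map_pow] at this
    exact this
  rw [h, ← Finset.prod_pow_eq_pow_sum]
  exact Ideal.prod_mem_prod fun i _ =>
    Ideal.pow_mem_pow (Ideal.subset_span (Set.mem_image_of_mem _ (hu i))) _

theorem coeff_mul_ne_zero {f g : Λ.germs} {α : Λ.Exp}
    (h : ((f * g : Λ.germs) : HahnSeries Λ.Exp ℂ).coeff α ≠ 0) :
    ∃ β γ : Λ.Exp, (f : HahnSeries Λ.Exp ℂ).coeff β ≠ 0 ∧
      (g : HahnSeries Λ.Exp ℂ).coeff γ ≠ 0 ∧ β + γ = α := by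
  obtain ⟨β, hβ, γ, hγ, h'⟩ := HahnSeries.support_mul_subset (x := (f : HahnSeries Λ.Exp ℂ))
    (y := g) (show α ∈ _ from h)
  exact ⟨β, γ, hβ, hγ, h'⟩

/-- The points `m ↦ exp (-s ⟨ξ, m⟩)` of the torus. For `ξ` in the interior of `σ` they tend to the
origin as `s → ∞`. -/
noncomputable def torusPoint (Λ : ToricSemigroup d) (ξ : Fin d → ℝ) (s : ℝ) : Λ.Point :=
  ⟨fun m => (Real.exp (-(s * Exp.weight Λ ξ m)) : ℂ), by simp, fun a b => by
    beta_reduce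
    rw [map_add, mul_add, neg_add, Real.exp_add, Complex.ofReal_mul]⟩

theorem torusPoint_eval (ξ : Fin d → ℝ) (s : ℝ) (m : Λ.Exp) :
    (torusPoint Λ ξ s).eval m = (Real.exp (-(s * Exp.weight Λ ξ m)) : ℂ) := rfl

theorem norm_torusPoint_eval (ξ : Fin d → ℝ) (s : ℝ) (m : Λ.Exp) :
    ‖(torusPoint Λ ξ s).eval m‖ = Real.exp (-(s * Exp.weight Λ ξ m)) := by
  rw [torusPoint_eval, Complex.norm_real, Real.norm_of_nonneg (Real.exp_pos _).le]

theorem origin_eval (m : Λ.Exp) (hm : m ≠ 0) : Λ.origin.eval m = 0 := if_neg hm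

theorem isInducing_eval : IsInducing (Point.eval : Λ.Point → Λ.Exp → ℂ) := IsInducing.subtypeVal

theorem tendsto_torusPoint {ξ : Fin d → ℝ} (hξ : ∀ α : Λ.Exp, α ≠ 0 → 0 < Exp.weight Λ ξ α) :
    Tendsto (torusPoint Λ ξ) atTop (𝓝 Λ.origin) := by
  rw [isInducing_eval.tendsto_nhds_iff, tendsto_pi_nhds]
  intro m
  by_cases hm : m = 0
  · subst hm
    simp only [Function.comp_apply, Point.eval_zero]
    exact tendsto_const_nhds
  · rw [origin_eval m hm, tendsto_zero_iff_norm_tendsto_zero]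
    simp only [Function.comp_apply, norm_torusPoint_eval]
    exact Real.tendsto_exp_neg_atTop_nhds_zero.comp
      (tendsto_id.atTop_mul_const (hξ m hm))

/-- The points near the origin are dominated by any given point of the torus. -/
theorem eventually_norm_eval_le (ξ : Fin d → ℝ) (s : ℝ) :
    ∀ᶠ x in 𝓝 Λ.origin, ∀ m : Λ.Exp, ‖x.eval m‖ ≤ Real.exp (-(s * Exp.weight Λ ξ m)) := by
  obtain ⟨G, hG0, hG⟩ := exists_generators Λ
  have h1 : ∀ᶠ x in 𝓝 Λ.origin, ∀ g ∈ G,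
      ‖x.eval g‖ < Real.exp (-(s * Exp.weight Λ ξ g)) := by
    rw [Filter.eventually_all_finset]
    intro g hg
    have hc : Continuous fun x : Λ.Point => ‖x.eval g‖ :=
      ((continuous_apply g).comp isInducing_eval.continuous).norm
    refine hc.continuousAt.eventually_lt continuousAt_const ?_
    rw [origin_eval g (fun h => hG0 (h ▸ hg)), norm_zero]
    exact Real.exp_pos _
  filter_upwards [h1] with x hx m
  have hm : m ∈ AddSubmonoid.closure (G : Set Λ.Exp) := hG ▸ AddSubmonoid.mem_top m
  induction hm using AddSubmonoid.closure_induction with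
  | mem g hg => exact (hx g hg).le
  | zero => simp [Point.eval_zero]
  | add a b _ _ ha hb =>
    rw [Point.eval_add, norm_mul, map_add, mul_add, neg_add, Real.exp_add]
    exact mul_le_mul ha hb (norm_nonneg _) (Real.exp_pos _).le

/-- The series `∑ c_{v + m} X ^ m` made of the multiples of `X ^ v` in `∑ c_m X ^ m`. -/
def quotSeries (f : HahnSeries Λ.Exp ℂ) (v : Λ.Exp) : HahnSeries Λ.Exp ℂ where
  coeff m := f.coeff (v + m)
  isPWO_support' := Exp.isPWO Λ _

/-- Near the origin the terms of `quotSeries f v` are dominated, up to a constant, by the terms of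
the given series at a point of the torus, where `X ^ v` does not vanish. -/
theorem quotSeries_mem {f : HahnSeries Λ.Exp ℂ} (hf : f ∈ Λ.germs) (v : Λ.Exp) :
    quotSeries f v ∈ Λ.germs := by
  obtain ⟨ξ, _, hξ⟩ := exists_pos_weight Λ
  obtain ⟨s, hs⟩ := ((tendsto_torusPoint hξ).eventually (mem_germs_iff.mp hf)).exists
  rw [mem_germs_iff]
  filter_upwards [eventually_norm_eval_le ξ s] with x hx
  refine Summable.of_norm_bounded ((hs.norm.comp_injective (add_right_injective v)).mul_right
    (Real.exp (s * Exp.weight Λ ξ v))) fun m => ?_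
  simp only [Function.comp_apply]
  rw [norm_mul, norm_mul, norm_torusPoint_eval, mul_assoc, ← Real.exp_add, map_add]
  refine mul_le_mul_of_nonneg_left ((hx m).trans_eq ?_) (norm_nonneg _)
  congr 1
  ring

/-- The germ defined by `quotSeries`. -/
def quotMonomial (f : Λ.germs) (v : Λ.Exp) : Λ.germs := ⟨quotSeries f v, quotSeries_mem f.2 v⟩

theorem quotMonomial_coeff (f : Λ.germs) (v m : Λ.Exp) :
    (quotMonomial f v : HahnSeries Λ.Exp ℂ).coeff m = (f : HahnSeries Λ.Exp ℂ).coeff (v + m) := rfl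

/-- A convergent series belongs to an ideal as soon as all its monomials do. -/
theorem mem_of_monomial_mem (𝔞 : Ideal Λ.germs) (f : Λ.germs)
    (h : ∀ α, (f : HahnSeries Λ.Exp ℂ).coeff α ≠ 0 → Λ.monomial α ∈ 𝔞) : f ∈ 𝔞 := by
  classical
  have key : ∀ F : Finset Λ.Exp, (∀ v ∈ F, Λ.monomial v ∈ 𝔞) → ∀ f : Λ.germs,
      (∀ α, (f : HahnSeries Λ.Exp ℂ).coeff α ≠ 0 → ∃ v ∈ F, v ≤ α) → f ∈ 𝔞 := by
    intro F
    induction F using Finset.induction_on with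
    | empty =>
      intro _ f hf
      have : f = 0 := Subtype.ext (HahnSeries.ext (funext fun α => by
        by_contra hc
        obtain ⟨v, hv, _⟩ := hf α hc
        simp at hv))
      rw [this]
      exact zero_mem _
    | insert v F _ ih =>
      intro hF f hf
      have hsplit : f =
          (f - Λ.monomial v * quotMonomial f v) + Λ.monomial v * quotMonomial f v := by ring
      have hcoeff : ∀ m, ((Λ.monomial v * quotMonomial f v : Λ.germs) :
          HahnSeries Λ.Exp ℂ).coeff (v + m) = (f : HahnSeries Λ.Exp ℂ).coeff (v + m) := fun m => by
        rw [Subring.coe_mul, add_comm v m]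
        change (HahnSeries.single v (1 : ℂ) * _).coeff (m + v) = _
        rw [HahnSeries.coeff_single_mul_add, one_mul, quotMonomial_coeff, add_comm]
      rw [hsplit]
      refine 𝔞.add_mem (ih (fun w hw => hF w (Finset.mem_insert_of_mem hw)) _ fun α hα => ?_)
        (𝔞.mul_mem_right _ (hF v (Finset.mem_insert_self v F)))
      have hv : ¬ v ≤ α := by
        rintro ⟨m, rfl⟩
        apply hα
        rw [AddSubgroupClass.coe_sub, HahnSeries.coeff_sub, hcoeff, sub_self]
      have h0 : ((Λ.monomial v * quotMonomial f v : Λ.germs) :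
          HahnSeries Λ.Exp ℂ).coeff α = 0 := by
        by_contra hc
        obtain ⟨β, γ, hβ, _, rfl⟩ := coeff_mul_ne_zero hc
        exact hv ⟨γ, by rw [monomial_coeff_ne_zero hβ]⟩
      rw [AddSubgroupClass.coe_sub, HahnSeries.coeff_sub, h0, sub_zero] at hα
      obtain ⟨w, hw, hwα⟩ := hf α hα
      rcases Finset.mem_insert.mp hw with rfl | hw
      · exact absurd hwα hv
      · exact ⟨w, hw, hwα⟩
  obtain ⟨F, hF, hle⟩ :=
    (Exp.isPWO Λ {α | (f : HahnSeries Λ.Exp ℂ).coeff α ≠ 0}).exists_finset_le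
  exact key F (fun v hv => h v (hF hv)) f fun α hα => hle α hα

/-! ### Monomial valuations -/

/-- The ideal of the series all of whose exponents have weight at least `r`. -/
def weightIdeal {η : Fin d → ℝ} (hη : η ∈ Λ.cone) (r : ℝ) : Ideal Λ.germs where
  carrier := {f | ∀ α, (f : HahnSeries Λ.Exp ℂ).coeff α ≠ 0 → r ≤ Exp.weight Λ η α}
  zero_mem' := fun α h => absurd rfl h
  add_mem' {f g} hf hg := fun α h => by
    by_cases h0 : (f : HahnSeries Λ.Exp ℂ).coeff α = 0
    · refine hg α fun h1 => h ?_
      rw [Subring.coe_add, HahnSeries.coeff_add, h0, h1, add_zero]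
    · exact hf α h0
  smul_mem' c f hf := fun α h => by
    obtain ⟨β, γ, _, hγ, rfl⟩ := coeff_mul_ne_zero h
    rw [map_add]
    linarith [hf γ hγ, mem_cone_iff.mp hη β]

theorem mem_weightIdeal {η : Fin d → ℝ} (hη : η ∈ Λ.cone) {r : ℝ} {f : Λ.germs} :
    f ∈ weightIdeal hη r ↔
      ∀ α, (f : HahnSeries Λ.Exp ℂ).coeff α ≠ 0 → r ≤ Exp.weight Λ η α := Iff.rfl

theorem weightIdeal_pow_le {η : Fin d → ℝ} (hη : η ∈ Λ.cone) (r : ℝ) (k : ℕ) :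
    weightIdeal hη r ^ k ≤ weightIdeal hη (k * r) := by
  induction k with
  | zero =>
    intro f _ α _
    simpa using mem_cone_iff.mp hη α
  | succ k ih =>
    rw [pow_succ]
    refine (Ideal.mul_mono_left ih).trans (Ideal.mul_le.mpr fun f hf g hg α h => ?_)
    obtain ⟨β, γ, hβ, hγ, rfl⟩ := coeff_mul_ne_zero h
    rw [map_add]
    push_cast
    linarith [hf β hβ, hg γ hγ]

theorem monomialIdeal_le_weightIdeal {η : Fin d → ℝ} (hη : η ∈ Λ.cone) {r : ℝ} {S : Set Λ.Exp}
    (h : ∀ u ∈ S, r ≤ Exp.weight Λ η u) : Λ.monomialIdeal S ≤ weightIdeal hη r := by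
  refine Ideal.span_le.mpr ?_
  rintro _ ⟨u, hu, rfl⟩ α hα
  rw [monomial_coeff_ne_zero hα]
  exact h u hu

/-- A monomial valuation does not increase faster than linearly on powers. The weight `η` is refined
to an injective monotone map to a totally ordered group, and the term of `φ` that is the least for
the refined order cannot cancel in `φ ^ k`. -/
theorem exists_coeff_pow_ne_zero {η : Fin d → ℝ} (hη : η ∈ Λ.cone) {φ : Λ.germs} {α : Λ.Exp}
    (hα : (φ : HahnSeries Λ.Exp ℂ).coeff α ≠ 0) (k : ℕ) :
    ∃ β, ((φ ^ k : Λ.germs) : HahnSeries Λ.Exp ℂ).coeff β ≠ 0 ∧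
      Exp.weight Λ η β ≤ k * Exp.weight Λ η α := by
  obtain ⟨ξ, hξ, hpos⟩ := exists_pos_weight Λ
  let L : Λ.Exp → ℝ ×ₗ (ℝ ×ₗ Lex (Fin d → ℤ)) := fun m =>
    toLex (Exp.weight Λ η m, toLex (Exp.weight Λ ξ m, toLex m.vec))
  have hLadd : ∀ a b, L (a + b) = L a + L b := fun a b => by
    simp only [L, map_add, Exp.vec_add]
    rfl
  have hLinj : Function.Injective L := fun a b h => by
    apply Exp.vec_injective
    have h1 := congrArg (fun z => (ofLex (ofLex z).2).2) h
    exact toLex.injective h1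
  have hLle : ∀ a b, L a ≤ L b → Exp.weight Λ η a ≤ Exp.weight Λ η b := fun a b h => by
    rcases Prod.Lex.toLex_le_toLex.mp h with h | h
    · exact h.le
    · exact h.1.le
  have hLmono : Monotone L := by
    rintro a b ⟨c, rfl⟩
    by_cases hc : c = 0
    · rw [hc, add_zero]
    refine Prod.Lex.toLex_le_toLex.mpr ?_
    rcases (mem_cone_iff.mp hη c).lt_or_eq with h | h
    · left
      simp only [map_add]
      linarith
    · right
      refine ⟨by simp only [map_add, ← h, add_zero], Prod.Lex.toLex_le_toLex.mpr (Or.inl ?_)⟩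
      simp only [map_add]
      linarith [hpos c hc]
  obtain ⟨F, hF, hle⟩ :=
    (Exp.isPWO Λ {α | (φ : HahnSeries Λ.Exp ℂ).coeff α ≠ 0}).exists_finset_le
  obtain ⟨f, hf, _⟩ := hle α hα
  obtain ⟨α₀, hα₀, hmin⟩ := F.exists_min_image L ⟨f, hf⟩
  have hmin' : ∀ β, (φ : HahnSeries Λ.Exp ℂ).coeff β ≠ 0 → L α₀ ≤ L β := fun β hβ => by
    obtain ⟨b, hb, hbβ⟩ := hle β hβ
    exact (hmin b hb).trans (hLmono hbβ)
  have key : ∀ k : ℕ, (∀ β, ((φ ^ k : Λ.germs) : HahnSeries Λ.Exp ℂ).coeff β ≠ 0 →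
      L (k • α₀) ≤ L β) ∧ ((φ ^ k : Λ.germs) : HahnSeries Λ.Exp ℂ).coeff (k • α₀) ≠ 0 := by
    intro k
    induction k with
    | zero =>
      simp only [pow_zero, zero_smul]
      rw [← monomial_zero]
      refine ⟨fun β hβ => by rw [monomial_coeff_ne_zero hβ], ?_⟩
      rw [monomial_coeff_self]
      exact one_ne_zero
    | succ k ih =>
      simp only [pow_succ, add_smul, one_smul]
      refine ⟨fun β hβ => ?_, ?_⟩
      · obtain ⟨γ, δ, hγ, hδ, rfl⟩ := coeff_mul_ne_zero hβ
        rw [hLadd, hLadd]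
        exact add_le_add (ih.1 γ hγ) (hmin' δ hδ)
      · rw [Subring.coe_mul, HahnSeries.coeff_mul, Finset.sum_eq_single (k • α₀, α₀)]
        · exact mul_ne_zero ih.2 (hF hα₀)
        · rintro ⟨γ, δ⟩ hp hne
          exfalso
          obtain ⟨hγ, hδ, hsum⟩ := Finset.mem_antidiagonal.mp hp
          have h1 := ih.1 γ hγ
          have h2 := hmin' δ hδ
          have h3 : L γ + L δ = L (k • α₀) + L α₀ := by
            rw [← hLadd, ← hLadd]
            exact congrArg L hsum
          have h4 : L δ = L α₀ := le_antisymm (by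
            by_contra hc
            push Not at hc
            exact absurd h3 (add_lt_add_of_le_of_lt h1 hc).ne') h2
          have h5 : δ = α₀ := hLinj h4
          have h6 : γ = k • α₀ := by
            have hsum' : γ + δ = k • α₀ + α₀ := hsum
            rw [h5] at hsum'
            exact add_right_cancel hsum'
          exact hne (by rw [h5, h6])
        · intro hp
          by_contra hc
          exact hp (Finset.mem_antidiagonal.mpr ⟨ih.2, hF hα₀, rfl⟩)
  refine ⟨k • α₀, (key k).2, ?_⟩
  rw [map_nsmul, nsmul_eq_mul]
  exact mul_le_mul_of_nonneg_left (hLle _ _ (hmin' α hα)) (Nat.cast_nonneg k)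

/-! ### Newton polyhedra and the vectors `n_k` -/

theorem add_mem_newton {S : Set Λ.Exp} {α : Λ.Exp} (hα : α ∈ S) (β : Λ.Exp) :
    toReal (α + β).vec ∈ Λ.newton S :=
  subset_convexHull ℝ _ (Set.mem_biUnion hα ⟨_, Exp.toReal_vec_mem Λ β, toReal_add _ _⟩)

theorem mem_newton {S : Set Λ.Exp} {α : Λ.Exp} (hα : α ∈ S) : toReal α.vec ∈ Λ.newton S := by
  simpa using add_mem_newton hα 0

theorem le_dotProduct_of_mem_newton {S : Set Λ.Exp} {η : Fin d → ℝ} (hη : η ∈ Λ.cone) {r : ℝ}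
    (hr : ∀ α ∈ S, r ≤ Exp.weight Λ η α) {v : Fin d → ℝ} (hv : v ∈ Λ.newton S) : r ≤ η ⬝ᵥ v := by
  have hconv : Convex ℝ {v : Fin d → ℝ | r ≤ η ⬝ᵥ v} :=
    convex_halfSpace_ge ⟨fun x y => dotProduct_add _ _ _, fun c x => dotProduct_smul _ _ _⟩ r
  refine convexHull_min (Set.iUnion₂_subset fun α hα => ?_) hconv hv
  rintro _ ⟨w, hw, rfl⟩
  have h1 := hr α hα
  have h2 := hη w hw
  rw [Exp.weight_apply] at h1
  simp only [Set.mem_ofPred_eq, dotProduct_add]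
  linarith

theorem supportFn_newton {S : Set Λ.Exp} {η : Fin d → ℝ} (hη : η ∈ Λ.cone) {α : Λ.Exp}
    (hα : α ∈ S) (hmin : ∀ β ∈ S, Exp.weight Λ η α ≤ Exp.weight Λ η β) :
    supportFn (Λ.newton S) η = ((Exp.weight Λ η α : ℝ) : EReal) :=
  le_antisymm (iInf₂_le _ (mem_newton hα)) (le_iInf₂ fun _ hv =>
    EReal.coe_le_coe_iff.mpr (le_dotProduct_of_mem_newton hη hmin hv))

theorem supportFn_newton_empty (η : Fin d → ℝ) : supportFn (Λ.newton ∅) η = ⊤ := by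
  simp [supportFn, newton]

/-- The set of the points of `P` at which `η` is minimal is exposed. -/
theorem isExposed_argmin (P : Set (Fin d → ℝ)) (η : Fin d → ℝ) :
    IsExposed ℝ P {x ∈ P | ∀ y ∈ P, η ⬝ᵥ x ≤ η ⬝ᵥ y} := by
  intro _
  refine ⟨(dotProductEquiv ℝ (Fin d) (-η)).toContinuousLinearMap, ?_⟩
  ext x
  simp

/-- The face of `σ` that contains `n` in its relative interior is cut out by the equations
`⟨ν, α⟩ = 0` for the exponents `α` with `⟨n, α⟩ = 0`. -/
theorem exists_face_mem_intrinsicInterior {n : Fin d → ℝ} (hn : n ∈ Λ.cone) :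
    ∃ τ, IsFace Λ.cone τ ∧ n ∈ intrinsicInterior ℝ τ := by
  classical
  obtain ⟨G, -, hG⟩ := exists_generators Λ
  set w : Fin d → ℝ := ∑ g ∈ G with Exp.weight Λ n g = 0, toReal g.vec with hw
  have hdot : ∀ ν, ν ⬝ᵥ w = ∑ g ∈ G with Exp.weight Λ n g = 0, Exp.weight Λ ν g := fun ν => by
    rw [hw, dotProduct_sum]
    rfl
  have hnw : n ⬝ᵥ w = 0 := by
    rw [hdot]
    exact Finset.sum_eq_zero fun g hg => (Finset.mem_filter.mp hg).2
  have hw0 : ∀ ν ∈ Λ.cone, 0 ≤ ν ⬝ᵥ w := fun ν hν => by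
    rw [hdot]
    exact Finset.sum_nonneg fun g _ => mem_cone_iff.mp hν g
  set τ : Set (Fin d → ℝ) := {x ∈ Λ.cone | ∀ y ∈ Λ.cone, w ⬝ᵥ x ≤ w ⬝ᵥ y} with hτ
  have hmemτ : ∀ ν, ν ∈ τ ↔
      ν ∈ Λ.cone ∧ ∀ g ∈ G, Exp.weight Λ n g = 0 → Exp.weight Λ ν g = 0 := by
    intro ν
    refine ⟨fun h => ⟨h.1, fun g hg hng => ?_⟩, fun h => ⟨h.1, fun y hy => ?_⟩⟩
    · have h1 : ν ⬝ᵥ w ≤ 0 := by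
        rw [dotProduct_comm, ← hnw, dotProduct_comm n]
        exact h.2 n hn
      rw [hdot] at h1
      have h2 := Finset.single_le_sum (f := fun g => Exp.weight Λ ν g)
        (fun g _ => mem_cone_iff.mp h.1 g)
        ((Finset.mem_filter (p := fun g => Exp.weight Λ n g = 0)).mpr ⟨hg, hng⟩)
      exact le_antisymm (h2.trans h1) (mem_cone_iff.mp h.1 g)
    · have h1 : ν ⬝ᵥ w = 0 := by
        rw [hdot]
        exact Finset.sum_eq_zero fun g hg =>
          h.2 g (Finset.mem_filter.mp hg).1 (Finset.mem_filter.mp hg).2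
      rw [dotProduct_comm, h1, dotProduct_comm]
      exact hw0 y hy
  have hnτ : n ∈ τ := (hmemτ n).mpr ⟨hn, fun _ _ h => h⟩
  refine ⟨τ, ⟨⟨n, hnτ⟩, isExposed_argmin _ w⟩, ?_⟩
  rw [mem_intrinsicInterior]
  refine ⟨⟨n, subset_affineSpan ℝ τ hnτ⟩, ?_, rfl⟩
  rw [mem_interior_iff_mem_nhds]
  have hopen : ∀ᶠ y : affineSpan ℝ τ in 𝓝 ⟨n, subset_affineSpan ℝ τ hnτ⟩,
      ∀ g ∈ G, Exp.weight Λ n g ≠ 0 → 0 < Exp.weight Λ (y : Fin d → ℝ) g := by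
    rw [Filter.eventually_all_finset]
    intro g _
    by_cases h0 : Exp.weight Λ n g = 0
    · exact Eventually.of_forall fun y h => absurd h0 h
    · have hc : Continuous fun y : affineSpan ℝ τ => Exp.weight Λ (y : Fin d → ℝ) g :=
        continuous_subtype_val.dotProduct continuous_const
      have hpos : 0 < Exp.weight Λ n g := lt_of_le_of_ne (mem_cone_iff.mp hn g) (Ne.symm h0)
      filter_upwards [continuousAt_const.eventually_lt (f := fun _ => (0 : ℝ))
        hc.continuousAt hpos] with y hy _ using hy
  filter_upwards [hopen] with y hy
  have hspan : ∀ g ∈ G, Exp.weight Λ n g = 0 → Exp.weight Λ (y : Fin d → ℝ) g = 0 := by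
    intro g hg hng
    have hy' : (y : Fin d → ℝ) ∈ Submodule.span ℝ τ := affineSpan_subset_span y.2
    generalize (y : Fin d → ℝ) = z at hy'
    induction hy' using Submodule.span_induction with
    | mem x hx => exact ((hmemτ x).mp hx).2 g hg hng
    | zero => simp [Exp.weight_apply]
    | add a b _ _ ha hb =>
      rw [Exp.weight_apply] at ha hb ⊢
      rw [add_dotProduct, ha, hb, add_zero]
    | smul c a _ ha =>
      rw [Exp.weight_apply] at ha ⊢
      rw [smul_dotProduct, ha, smul_zero]
  refine (hmemτ y).mpr ⟨mem_cone_of_generators hG fun g hg => ?_, hspan⟩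
  by_cases h0 : Exp.weight Λ n g = 0
  · exact (hspan g hg h0).ge
  · exact (hy g hg h0).le

open Classical in
/-- The distinguished point of the orbit of a subset `τ` of `σ`. -/
noncomputable def orbPoint {τ : Set (Fin d → ℝ)} (hτ : τ ⊆ Λ.cone) : Λ.Point :=
  ⟨fun m => if ∀ ν ∈ τ, Exp.weight Λ ν m = 0 then 1 else 0, by simp, fun a b => by
    have : (∀ ν ∈ τ, Exp.weight Λ ν (a + b) = 0) ↔
        (∀ ν ∈ τ, Exp.weight Λ ν a = 0) ∧ (∀ ν ∈ τ, Exp.weight Λ ν b = 0) := by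
      refine ⟨fun h => ⟨fun ν hν => ?_, fun ν hν => ?_⟩, fun h ν hν => ?_⟩
      · have := h ν hν
        rw [map_add] at this
        linarith [mem_cone_iff.mp (hτ hν) a, mem_cone_iff.mp (hτ hν) b]
      · have := h ν hν
        rw [map_add] at this
        linarith [mem_cone_iff.mp (hτ hν) a, mem_cone_iff.mp (hτ hν) b]
      · rw [map_add, h.1 ν hν, h.2 ν hν, add_zero]
    simp only [this]
    split_ifs <;> first | (simp; done) | (exfalso; tauto)⟩

theorem orbPoint_eval_ne_zero {τ : Set (Fin d → ℝ)} (hτ : τ ⊆ Λ.cone) (m : Λ.Exp) :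
    (orbPoint hτ).eval m ≠ 0 ↔ ∀ ν ∈ τ, Exp.weight Λ ν m = 0 := by
  classical
  change (if ∀ ν ∈ τ, Exp.weight Λ ν m = 0 then (1 : ℂ) else 0) ≠ 0 ↔ _
  split_ifs with h
  · exact ⟨fun _ => h, fun _ => one_ne_zero⟩
  · exact ⟨fun h' => absurd rfl h', fun h' => absurd h' h⟩

theorem cone_of_mem_excVectors {I : Set Λ.Exp} {n : Fin d → ℤ} (hn : n ∈ Λ.excVectors I) :
    toReal n ∈ Λ.cone := by
  obtain ⟨-, ⟨ρ, ⟨F, -, rfl⟩, -, hρ⟩, -⟩ := hn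
  exact hρ.1

/-- The condition on the orbits in the definition of the vectors `n_k` forces `ord_I (n_k) > 0`. -/
theorem one_le_weight_of_mem_excVectors {I : Set Λ.Exp} {n : Fin d → ℤ}
    (hn : n ∈ Λ.excVectors I) {u : Λ.Exp} (hu : u ∈ I) : 1 ≤ Exp.weight Λ (toReal n) u := by
  have hcone := cone_of_mem_excVectors hn
  obtain ⟨-, -, τ, ⟨-, hτ⟩, hint, horb⟩ := hn
  have hτσ : τ ⊆ Λ.cone := hτ.subset
  have hpos : 0 < Exp.weight Λ (toReal n) u := by
    refine lt_of_le_of_ne (mem_cone_iff.mp hcone u) fun h0 => ?_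
    -- a linear form that is nonnegative on `τ` and vanishes at a relative interior point is zero
    have hvan : ∀ ν ∈ τ, Exp.weight Λ ν u = 0 := by
      intro ν hν
      obtain ⟨y, hy, hyn⟩ := mem_intrinsicInterior.mp hint
      let f : ℝ → affineSpan ℝ τ := fun ε =>
        ⟨AffineMap.lineMap (y : Fin d → ℝ) ν (-ε),
          AffineMap.lineMap_mem _ y.2 (subset_affineSpan ℝ τ hν)⟩
      have hf : Continuous f := by
        refine Continuous.subtype_mk ?_ _
        simp only [AffineMap.lineMap_apply_module]
        fun_prop
      have hf0 : f 0 = y := Subtype.ext (by simp [f])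
      have hev : ∀ᶠ ε in 𝓝 (0 : ℝ), f ε ∈ ((↑) ⁻¹' τ : Set (affineSpan ℝ τ)) := by
        refine hf.continuousAt.eventually ?_
        rw [hf0]
        exact mem_interior_iff_mem_nhds.mp hy
      obtain ⟨ε, hε, hε0⟩ := ((hev.filter_mono nhdsWithin_le_nhds).and
        (self_mem_nhdsWithin (a := (0 : ℝ)) (s := Set.Ioi 0))).exists
      have h1 := mem_cone_iff.mp (hτσ hε) u
      have h2 : Exp.weight Λ (f ε : Fin d → ℝ) u = -ε * Exp.weight Λ ν u := by
        simp only [f, AffineMap.lineMap_apply_module, hyn, Exp.weight_apply]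
        rw [Exp.weight_apply] at h0
        rw [add_dotProduct, smul_dotProduct, smul_dotProduct, ← h0]
        simp
      rw [h2] at h1
      have h3 := mem_cone_iff.mp (hτσ hν) u
      have hε0' : 0 < ε := hε0
      by_contra hne
      have := mul_pos hε0' (lt_of_le_of_ne h3 (Ne.symm hne))
      linarith
    exact ((orbPoint_eval_ne_zero hτσ u).mpr hvan)
      (horb (fun m => orbPoint_eval_ne_zero hτσ m) u hu)
  rw [Exp.weight_apply, toReal_dotProduct] at hpos ⊢
  exact_mod_cast hpos

/-- A criterion for a primitive vector of `σ` to be one of the `n_k`: it is positive on `I`, and it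
is determined up to scaling by the face of the Newton polyhedron on which it is minimal. -/
theorem mem_excVectors {I : Set Λ.Exp} {n : Fin d → ℤ} (hn : IsPrimitive n)
    (hcone : toReal n ∈ Λ.cone) {u₀ : Λ.Exp} (hu₀ : u₀ ∈ I)
    (hmin : ∀ u ∈ I, Exp.weight Λ (toReal n) u₀ ≤ Exp.weight Λ (toReal n) u)
    (hpos : 0 < Exp.weight Λ (toReal n) u₀)
    (H : ∀ (η : Fin d → ℝ) (r : ℝ),
      (∀ α, Exp.weight Λ (toReal n) α = 0 → Exp.weight Λ η α = 0) →
      (∀ u ∈ I, Exp.weight Λ (toReal n) u = Exp.weight Λ (toReal n) u₀ → Exp.weight Λ η u = r) →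
      ∃ c : ℝ, η = c • toReal n) : n ∈ Λ.excVectors I := by
  have hle : ∀ v ∈ Λ.newton I, Exp.weight Λ (toReal n) u₀ ≤ toReal n ⬝ᵥ v := fun v hv =>
    le_dotProduct_of_mem_newton hcone hmin hv
  set F := {x ∈ Λ.newton I | ∀ y ∈ Λ.newton I, toReal n ⬝ᵥ x ≤ toReal n ⬝ᵥ y} with hF
  have hmemF : ∀ u ∈ I, Exp.weight Λ (toReal n) u = Exp.weight Λ (toReal n) u₀ → ∀ α,
      Exp.weight Λ (toReal n) α = 0 → toReal (u + α).vec ∈ F := by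
    intro u hu h1 α h2
    refine ⟨add_mem_newton hu α, fun y hy => ?_⟩
    rw [← Exp.weight_apply, map_add, h1, h2, add_zero]
    exact hle y hy
  have hmemF' : ∀ u ∈ I, Exp.weight Λ (toReal n) u = Exp.weight Λ (toReal n) u₀ →
      toReal u.vec ∈ F := fun u hu h1 => by
    simpa using hmemF u hu h1 0 (map_zero _)
  have hnρ : toReal n ∈ Λ.faceCone (Λ.newton I) F := by
    refine ⟨hcone, fun v hv => ?_⟩
    rw [supportFn_newton hcone hu₀ hmin]
    exact congrArg _ (le_antisymm (hv.2 _ (mem_newton hu₀)) (hle v hv.1))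
  have hρ : ∀ η ∈ Λ.faceCone (Λ.newton I) F, ∃ c : ℝ, η = c • toReal n := by
    rintro η ⟨_, hη⟩
    have hval : ∀ v ∈ F, η ⬝ᵥ v = Exp.weight Λ η u₀ := fun v hv => by
      have := (hη v hv).trans (hη _ (hmemF' u₀ hu₀ rfl)).symm
      exact EReal.coe_eq_coe_iff.mp this
    refine H η (Exp.weight Λ η u₀) (fun α hα => ?_) fun u hu h1 => hval _ (hmemF' u hu h1)
    have := hval _ (hmemF u₀ hu₀ rfl α hα)
    rw [← Exp.weight_apply, map_add] at this
    linarith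
  refine ⟨hn, ⟨_, ⟨F, ⟨⟨_, hmemF' u₀ hu₀ rfl⟩, isExposed_argmin _ _⟩, rfl⟩, ?_, hnρ⟩, ?_⟩
  · have hspan : Submodule.span ℝ (Λ.faceCone (Λ.newton I) F) = Submodule.span ℝ {toReal n} := by
      refine le_antisymm (Submodule.span_le.mpr fun η hη => ?_)
        (Submodule.span_mono (Set.singleton_subset_iff.mpr hnρ))
      obtain ⟨c, rfl⟩ := hρ η hη
      exact Submodule.smul_mem _ _ (Submodule.mem_span_singleton_self _)
    rw [hspan, finrank_span_singleton]
    intro h0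
    refine hn.ne_zero (toReal_injective (h0.trans ?_))
    funext i
    simp [toReal]
  · obtain ⟨τ, hτ, hint⟩ := exists_face_mem_intrinsicInterior hcone
    refine ⟨τ, hτ, hint, fun x hx u hu => ?_⟩
    by_contra hc
    have h0 := (hx u).mp hc _ (intrinsicInterior_subset hint)
    have h1 := hmin u hu
    rw [Exp.weight_apply _ u, h0] at h1
    linarith

/-! ### Facets of the Newton polyhedron -/

theorem vecTail_smul (c : ℝ) (y : Fin (d + 1) → ℝ) :
    Matrix.vecTail (c • y) = c • Matrix.vecTail y := rfl

/-- The generators of the cone over the Newton polyhedron in `ℝ × M_ℝ`: the vectors `(1, u)` for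
the generators `u` of the ideal, and `(0, g)` for the generators `g` of `Λ`. -/
def coneGen (U G : Finset Λ.Exp) : U ⊕ G → Fin (d + 1) → ℤ :=
  Sum.elim (fun u => Matrix.vecCons 1 u.1.vec) (fun g => Matrix.vecCons 0 g.1.vec)

theorem dotProduct_coneGen_inl (U G : Finset Λ.Exp) (y : Fin (d + 1) → ℝ) (u : U) :
    y ⬝ᵥ toReal (coneGen U G (Sum.inl u)) =
      Matrix.vecHead y + Exp.weight Λ (Matrix.vecTail y) u.1 := by
  have : toReal (coneGen U G (Sum.inl u)) = Matrix.vecCons 1 (toReal u.1.vec) := by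
    funext k
    refine Fin.cases ?_ (fun k => ?_) k <;> simp [coneGen, toReal]
  rw [this, Matrix.dotProduct_cons, mul_one, Exp.weight_apply]

theorem dotProduct_coneGen_inr (U G : Finset Λ.Exp) (y : Fin (d + 1) → ℝ) (g : G) :
    y ⬝ᵥ toReal (coneGen U G (Sum.inr g)) = Exp.weight Λ (Matrix.vecTail y) g.1 := by
  have : toReal (coneGen U G (Sum.inr g)) = Matrix.vecCons 0 (toReal g.1.vec) := by
    funext k
    refine Fin.cases ?_ (fun k => ?_) k <;> simp [coneGen, toReal]
  rw [this, Matrix.dotProduct_cons, mul_zero, zero_add, Exp.weight_apply]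

/-- The cone over the Newton polyhedron has full dimension, so its dual contains no line. -/
theorem eq_zero_of_dotProduct_coneGen {U G : Finset Λ.Exp} (hU : U.Nonempty)
    (hG : AddSubmonoid.closure (G : Set Λ.Exp) = ⊤) {y : Fin (d + 1) → ℝ}
    (hy : ∀ i, y ⬝ᵥ toReal (coneGen U G i) = 0) : y = 0 := by
  have hw : ∀ α : Λ.Exp, Exp.weight Λ (Matrix.vecTail y) α = 0 := fun α => by
    have hα : α ∈ AddSubmonoid.closure (G : Set Λ.Exp) := hG ▸ AddSubmonoid.mem_top α
    induction hα using AddSubmonoid.closure_induction with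
    | mem g hg => rw [← dotProduct_coneGen_inr U G y ⟨g, hg⟩]; exact hy _
    | zero => exact map_zero _
    | add a b _ _ ha hb => rw [map_add, ha, hb, add_zero]
  obtain ⟨u, hu⟩ := hU
  have h1 := hy (Sum.inl ⟨u, hu⟩)
  rw [dotProduct_coneGen_inl, hw, add_zero] at h1
  rw [← Matrix.cons_head_tail y, h1, eq_zero_of_weight_eq_zero hw]
  simp

/-- An extremal ray of the dual of the cone over the Newton polyhedron that is positive on `I` is
spanned by `(-ord_I (n), n)` for one of the vectors `n = n_k`. -/
theorem exists_excVector_of_extremal {I : Set Λ.Exp} {U G : Finset Λ.Exp} (hI : I.Nonempty)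
    (hUI : (U : Set Λ.Exp) ⊆ I) (hU : ∀ a ∈ I, ∃ u ∈ U, u ≤ a)
    (hG : AddSubmonoid.closure (G : Set Λ.Exp) = ⊤) {y : Fin (d + 1) → ℝ}
    (hy : ∀ i, 0 ≤ y ⬝ᵥ toReal (coneGen U G i))
    (hext : ∀ z : Fin (d + 1) → ℝ, (∀ i, y ⬝ᵥ toReal (coneGen U G i) = 0 →
      z ⬝ᵥ toReal (coneGen U G i) = 0) → ∃ c : ℝ, z = c • y)
    (hpos : ∀ u ∈ I, 0 < Exp.weight Λ (Matrix.vecTail y) u) :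
    ∃ n ∈ Λ.excVectors I, ∃ c : ℝ, 0 < c ∧ Matrix.vecTail y = c • toReal n ∧
      ∃ u ∈ I, Matrix.vecHead y = -Exp.weight Λ (Matrix.vecTail y) u ∧
        ∀ v ∈ I, Exp.weight Λ (Matrix.vecTail y) u ≤ Exp.weight Λ (Matrix.vecTail y) v := by
  classical
  set η := Matrix.vecTail y with hη
  set s := Matrix.vecHead y with hs
  have hcone : η ∈ Λ.cone := mem_cone_of_generators hG fun g hg => by
    have := hy (Sum.inr ⟨g, hg⟩)
    rwa [dotProduct_coneGen_inr] at this
  have hη0 : η ≠ 0 := fun h0 => by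
    obtain ⟨u, hu⟩ := hI
    have := hpos u hu
    rw [h0] at this
    simp [Exp.weight_apply] at this
  have hy0 : y ≠ 0 := fun h0 => hη0 (by rw [hη, h0]; rfl)
  -- some constraint coming from the ideal vanishes, as otherwise `(1, 0)` spans the ray too
  obtain ⟨u, hu⟩ : ∃ u : U, s + Exp.weight Λ η u.1 = 0 := by
    by_contra hc
    push Not at hc
    obtain ⟨c, hc'⟩ := hext (Matrix.vecCons 1 0) (by
      rintro (u | g) h
      · rw [dotProduct_coneGen_inl] at h
        exact absurd h (hc u)
      · rw [dotProduct_coneGen_inr]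
        simp [Exp.weight_apply])
    have h1 : (1 : ℝ) = c * s := congrArg Matrix.vecHead hc'
    have h2 : (0 : Fin d → ℝ) = c • η := congrArg Matrix.vecTail hc'
    rcases smul_eq_zero.mp h2.symm with h | h
    · rw [h, zero_mul] at h1
      exact one_ne_zero h1
    · exact hη0 h
  have huI : u.1 ∈ I := hUI u.2
  have hmin : ∀ v ∈ I, Exp.weight Λ η u.1 ≤ Exp.weight Λ η v := fun v hv => by
    obtain ⟨w, hw, hwv⟩ := hU v hv
    have h1 := hy (Sum.inl ⟨w, hw⟩)
    rw [dotProduct_coneGen_inl] at h1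
    have h2 := Exp.weight_mono hcone hwv
    change 0 ≤ s + Exp.weight Λ η w at h1
    linarith
  -- the ray is rational
  obtain ⟨z, hz0, hz⟩ := exists_int_ker
    (fun i : {i // y ⬝ᵥ toReal (coneGen U G i) = 0} => coneGen U G i.1) y hy0 (fun i => i.2)
  obtain ⟨c, hc⟩ := hext (toReal z) (fun i hi => by
    rw [toReal_dotProduct, hz ⟨i, hi⟩, Int.cast_zero])
  have hc0 : c ≠ 0 := by
    rintro rfl
    refine hz0 (toReal_injective ?_)
    rw [hc]
    funext k
    simp [toReal]
  have htail : toReal (Matrix.vecTail z) = c • η := by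
    have := congrArg Matrix.vecTail hc
    rw [vecTail_smul] at this
    rw [← this]
    rfl
  have hz0' : Matrix.vecTail z ≠ 0 := fun h0 => by
    rw [h0] at htail
    have : (0 : Fin d → ℝ) = c • η := by
      rw [← htail]
      funext k
      simp [toReal]
    exact (smul_ne_zero hc0 hη0) this.symm
  obtain ⟨g, m, hg, hm, hgm⟩ := exists_primitive _ hz0'
  have hηm : η = ((g : ℝ) / c) • toReal m := by
    have h1 : toReal (Matrix.vecTail z) = (g : ℝ) • toReal m := by
      rw [hgm]
      funext k
      simp [toReal]
    rw [h1] at htail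
    rw [div_eq_inv_mul, mul_smul, htail, smul_smul, inv_mul_cancel₀ hc0, one_smul]
  obtain ⟨n, hn, c', hc', hηn⟩ : ∃ n : Fin d → ℤ, IsPrimitive n ∧ ∃ c' : ℝ, 0 < c' ∧
      η = c' • toReal n := by
    have hne : (g : ℝ) / c ≠ 0 := div_ne_zero (Int.cast_ne_zero.mpr hg) hc0
    rcases lt_or_gt_of_ne hne with h | h
    · refine ⟨-m, hm.neg, -((g : ℝ) / c), by linarith, ?_⟩
      rw [hηm]
      funext k
      simp [toReal]
    · exact ⟨m, hm, _, h, hηm⟩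
  have hweight : ∀ α, Exp.weight Λ η α = c' * Exp.weight Λ (toReal n) α := fun α => by
    rw [Exp.weight_apply, Exp.weight_apply, hηn, smul_dotProduct, smul_eq_mul]
  refine ⟨n, ?_, c', hc', hηn, u.1, huI, by linarith, hmin⟩
  refine mem_excVectors hn (mem_cone_iff.mpr fun α => ?_) huI (fun v hv => ?_) ?_
    fun η' r h1 h2 => ?_
  · have := mem_cone_iff.mp hcone α
    rw [hweight] at this
    exact (mul_nonneg_iff_of_pos_left hc').mp this
  · have := hmin v hv
    rw [hweight, hweight] at this
    exact le_of_mul_le_mul_left this hc'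
  · have := hpos u.1 huI
    rw [hweight] at this
    exact (mul_pos_iff_of_pos_left hc').mp this
  · obtain ⟨e, he⟩ := hext (Matrix.vecCons (-r) η') (by
      rintro (v | g) h
      · rw [dotProduct_coneGen_inl] at h ⊢
        change s + Exp.weight Λ η v.1 = 0 at h
        have h3 : Exp.weight Λ η v.1 = Exp.weight Λ η u.1 := by linarith
        rw [hweight, hweight] at h3
        have h4 := h2 v.1 (hUI v.2) (mul_left_cancel₀ hc'.ne' h3)
        rw [Matrix.head_cons, Matrix.tail_cons, h4]
        ring
      · rw [dotProduct_coneGen_inr] at h ⊢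
        change Exp.weight Λ η g.1 = 0 at h
        rw [hweight] at h
        exact h1 _ ((mul_eq_zero.mp h).resolve_left hc'.ne'))
    refine ⟨e * c', ?_⟩
    have := congrArg Matrix.vecTail he
    rw [Matrix.tail_cons, vecTail_smul] at this
    rw [this, mul_smul, ← hηn]

/-- Finitely many of the vectors `n_k` decide which monomials belong to the powers of the ideal, up
to a bounded shift of the exponent of the power: the inequalities `⟨n_k, β⟩ ≥ t ord_I (n_k)` place
`β` in `t N(I)`, and then `X ^ β` in `I ^ m` for all `m ≤ t - K`. -/
theorem exists_finset_excVectors {I : Set Λ.Exp} (hI : I.Nonempty) :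
    ∃ (E : Finset (Fin d → ℤ)) (K : ℕ), (E : Set (Fin d → ℤ)) ⊆ Λ.excVectors I ∧
      ∀ (β : Λ.Exp) (t : ℝ), 0 ≤ t →
        (∀ n ∈ E, ∀ r : ℝ, (∀ u ∈ I, r ≤ Exp.weight Λ (toReal n) u) →
          t * r ≤ Exp.weight Λ (toReal n) β) →
        ∀ m : ℕ, (m : ℝ) + K ≤ t → Λ.monomial β ∈ Λ.monomialIdeal I ^ m := by
  classical
  obtain ⟨U, hUI, hU⟩ := (Exp.isPWO Λ I).exists_finset_le
  obtain ⟨G, -, hG⟩ := exists_generators Λ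
  have hUne : U.Nonempty := by
    obtain ⟨a, ha⟩ := hI
    obtain ⟨u, hu, _⟩ := hU a ha
    exact ⟨u, hu⟩
  obtain ⟨K, hK⟩ := exists_rounding_const (Λ := Λ) (fun u : U => u.1) (fun g : G => g.1)
  -- one vector for each set of constraints that vanish on a ray of the right kind
  let Good : Finset (U ⊕ G) → (Fin d → ℤ) → Prop := fun S n => n ∈ Λ.excVectors I ∧
    ∀ y : Fin (d + 1) → ℝ, (∀ i, 0 ≤ y ⬝ᵥ toReal (coneGen U G i)) →
      (∀ i, i ∈ S ↔ y ⬝ᵥ toReal (coneGen U G i) = 0) → y ≠ 0 →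
      ∃ c : ℝ, 0 < c ∧ Matrix.vecTail y = c • toReal n
  -- two rays of the dual cone with the same vanishing constraints are equal
  have hgood : ∀ y : Fin (d + 1) → ℝ, (∀ i, 0 ≤ y ⬝ᵥ toReal (coneGen U G i)) →
      (∀ z : Fin (d + 1) → ℝ, (∀ i, y ⬝ᵥ toReal (coneGen U G i) = 0 →
        z ⬝ᵥ toReal (coneGen U G i) = 0) → ∃ c : ℝ, z = c • y) →
      (∀ u ∈ I, 0 < Exp.weight Λ (Matrix.vecTail y) u) →
      ∃ n, Good (Finset.univ.filter fun i => y ⬝ᵥ toReal (coneGen U G i) = 0) n := by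
    intro y hy hext hpos
    obtain ⟨n, hn, c, hc, hyn, -⟩ := exists_excVector_of_extremal hI hUI hU hG hy hext hpos
    refine ⟨n, hn, fun y' hy' hact hy'0 => ?_⟩
    obtain ⟨e, he⟩ := hext y' fun i hi => (hact i).mp (by simpa using hi)
    have he0 : 0 < e := by
      by_contra hneg
      push Not at hneg
      have hy0 : y = 0 ∨ e = 0 := by
        by_contra hne
        push Not at hne
        refine hne.1 (eq_zero_of_dotProduct_coneGen hUne hG fun i => ?_)
        have h1 := hy' i
        rw [he, smul_dotProduct, smul_eq_mul] at h1
        have h2 : e < 0 := lt_of_le_of_ne hneg hne.2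
        nlinarith [hy i]
      rcases hy0 with h0 | h0 <;> exact hy'0 (by rw [he, h0]; simp)
    refine ⟨e * c, mul_pos he0 hc, ?_⟩
    rw [he, vecTail_smul, hyn, mul_smul]
  let E : Finset (Fin d → ℤ) := (Finset.univ.filter fun S : Finset (U ⊕ G) => ∃ n, Good S n).image
    fun S => if h : ∃ n, Good S n then h.choose else 0
  refine ⟨E, K, ?_, fun β t ht hβ m hm => ?_⟩
  · intro n hn
    obtain ⟨S, hS, rfl⟩ := Finset.mem_image.mp (Finset.mem_coe.mp hn)
    have h : ∃ n, Good S n := (Finset.mem_filter.mp hS).2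
    rw [dif_pos h]
    exact h.choose_spec.1
  -- by Farkas' lemma, `(t, β)` lies in the cone over the Newton polyhedron
  obtain ⟨c, hc, hb⟩ := exists_nonneg_sum_of_dual Finset.univ
    (fun i => toReal (coneGen U G i)) (Matrix.vecCons t (toReal β.vec)) (by
    intro f hf
    by_contra hneg
    push Not at hneg
    obtain ⟨y, hy, hyb, hext⟩ := exists_extremal_ray (fun i => toReal (coneGen U G i))
      (fun y hy => eq_zero_of_dotProduct_coneGen hUne hG hy) _ f
      (fun i => hf i (Finset.mem_univ i)) hneg
    rw [Matrix.dotProduct_cons, ← Exp.weight_apply] at hyb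
    have hcone : Matrix.vecTail y ∈ Λ.cone := mem_cone_of_generators hG fun g hg => by
      have := hy (Sum.inr ⟨g, hg⟩)
      rwa [dotProduct_coneGen_inr] at this
    have hβ0 := mem_cone_iff.mp hcone β
    have hhead : Matrix.vecHead y < 0 := by
      by_contra hc
      push Not at hc
      linarith [mul_nonneg hc ht]
    have hpos : ∀ u ∈ I, 0 < Exp.weight Λ (Matrix.vecTail y) u := fun u hu => by
      obtain ⟨v, hv, hvu⟩ := hU u hu
      have h1 := hy (Sum.inl ⟨v, hv⟩)
      rw [dotProduct_coneGen_inl] at h1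
      have h2 := Exp.weight_mono hcone hvu
      change 0 ≤ Matrix.vecHead y + Exp.weight Λ (Matrix.vecTail y) v at h1
      linarith
    have hex := hgood y hy hext hpos
    have hmemE : hex.choose ∈ E := Finset.mem_image.mpr
      ⟨_, Finset.mem_filter.mpr ⟨Finset.mem_univ _, hex⟩, dif_pos hex⟩
    obtain ⟨c, hc, hyc⟩ := hex.choose_spec.2 y hy (fun i => by simp) (by
      rintro rfl
      exact hhead.ne rfl)
    obtain ⟨-, -, -, -, -, u, hu, hhu, hmin⟩ :=
      exists_excVector_of_extremal hI hUI hU hG hy hext hpos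
    have hweight : ∀ α, Exp.weight Λ (Matrix.vecTail y) α =
        c * Exp.weight Λ (toReal hex.choose) α := fun α => by
      rw [Exp.weight_apply, Exp.weight_apply, hyc, smul_dotProduct, smul_eq_mul]
    have h1 := hβ _ hmemE (Exp.weight Λ (toReal hex.choose) u) fun v hv => by
      have := hmin v hv
      rw [hweight, hweight] at this
      exact le_of_mul_le_mul_left this hc
    rw [hhu, hweight, hweight] at hyb
    have h2 := mul_le_mul_of_nonneg_left h1 hc.le
    linarith)
  rw [Fintype.sum_sum_type] at hb
  have hhead : t = ∑ u : U, c (Sum.inl u) := by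
    have := congrFun hb 0
    simpa [coneGen, toReal] using this
  have htail : toReal β.vec = ∑ u : U, c (Sum.inl u) • toReal u.1.vec +
      ∑ g : G, c (Sum.inr g) • toReal g.1.vec := by
    funext k
    have := congrFun hb k.succ
    simpa [coneGen, toReal] using this
  obtain ⟨n, γ, hβγ, hn⟩ := hK (fun u => c (Sum.inl u)) (fun g => c (Sum.inr g)) β
    (fun _ => hc _) (fun _ => hc _) htail
  have hle : m ≤ ∑ u, n u := by
    have : (m : ℝ) + K ≤ ((∑ u, n u + K : ℕ) : ℝ) := hm.trans (hhead.le.trans hn)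
    have h2 : m + K ≤ ∑ u, n u + K := by exact_mod_cast this
    omega
  rw [hβγ, monomial_add]
  exact Ideal.mul_mem_right _ _ (Ideal.pow_le_pow_right hle
    (monomial_sum_mem_pow (fun u : U => u.1) (fun u => hUI u.2) n))

end ToricSemigroup

/-! ### Asymptotic orders -/

theorem natCast_le_iSup_iff {P : ℕ → Prop} (h0 : P 0) (hP : ∀ m n, m ≤ n → P n → P m) (m : ℕ) :
    (m : ℕ∞) ≤ ⨆ n ∈ {n : ℕ | P n}, (n : ℕ∞) ↔ P m := by
  refine ⟨fun h => ?_, fun h => le_iSup₂_of_le m h le_rfl⟩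
  by_contra hm
  obtain ⟨l, rfl⟩ : ∃ l, m = l + 1 := Nat.exists_eq_succ_of_ne_zero fun h => hm (h ▸ h0)
  have hle : ⨆ n ∈ {n : ℕ | P n}, (n : ℕ∞) ≤ (l : ℕ∞) := iSup₂_le fun n hn => by
    refine Nat.cast_le.mpr ?_
    by_contra hc
    exact hm (hP _ _ (by omega) hn)
  have := Nat.cast_le.mp (h.trans hle)
  omega

theorem natCast_le_nu_iff {A : Type*} [CommRing A] (I : Ideal A) (a : A) (m : ℕ) :
    (m : ℕ∞) ≤ nu I a ↔ a ∈ I ^ m :=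
  natCast_le_iSup_iff (P := fun n => a ∈ I ^ n) (by simp)
    (fun _ _ h ha => Ideal.pow_le_pow_right h ha) m

theorem natCast_le_nuIdeal_iff {A : Type*} [CommRing A] (I J : Ideal A) (m : ℕ) :
    (m : ℕ∞) ≤ nuIdeal I J ↔ J ≤ I ^ m :=
  natCast_le_iSup_iff (P := fun n => J ≤ I ^ n) (by simp)
    (fun _ _ h ha => ha.trans (Ideal.pow_le_pow_right h)) m

/-- An integer sequence that stays at bounded distance below `c k` has slope `c`. -/
theorem tendsto_div_of_floor_le {a : ℕ → ℕ∞} {c : ℝ} (hc : 0 ≤ c) (K : ℕ)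
    (hlow : ∀ k : ℕ, ((⌊c * k⌋₊ - K : ℕ) : ℕ∞) ≤ a k)
    (hup : ∀ k : ℕ, a k ≤ ((⌊c * k⌋₊ : ℕ) : ℕ∞)) :
    Tendsto (fun k : ℕ => (a k : ℝ≥0∞) / (k : ℝ≥0∞)) atTop (𝓝 (ENNReal.ofReal c)) := by
  have hfl : Tendsto (fun k : ℕ => ((⌊c * k⌋₊ : ℕ) : ℝ) / k) atTop (𝓝 c) :=
    (tendsto_nat_floor_mul_div_atTop hc).comp tendsto_natCast_atTop_atTop
  have hK : Tendsto (fun k : ℕ => (K : ℝ) / k) atTop (𝓝 0) :=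
    tendsto_const_div_atTop_nhds_zero_nat _
  have hl := ENNReal.tendsto_ofReal (hfl.sub hK)
  rw [sub_zero] at hl
  have hcast : ∀ (x : ℕ) {k : ℕ}, 0 < k →
      ((x : ℕ∞) : ℝ≥0∞) / (k : ℝ≥0∞) = ENNReal.ofReal ((x : ℝ) / k) := fun x k hk => by
    rw [ENNReal.ofReal_div_of_pos (Nat.cast_pos.mpr hk), ENNReal.ofReal_natCast,
      ENNReal.ofReal_natCast]
    rfl
  refine tendsto_of_tendsto_of_tendsto_of_le_of_le' hl (ENNReal.tendsto_ofReal hfl) ?_ ?_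
  · filter_upwards [eventually_gt_atTop 0] with k hk
    refine le_trans ?_ (ENNReal.div_le_div_right (ENat.toENNReal_le.mpr (hlow k)) _)
    rw [hcast _ hk, ← sub_div]
    refine ENNReal.ofReal_le_ofReal (div_le_div_of_nonneg_right ?_ (Nat.cast_nonneg k))
    rw [sub_le_iff_le_add]
    exact_mod_cast (by omega : ⌊c * k⌋₊ ≤ ⌊c * k⌋₊ - K + K)
  · filter_upwards [eventually_gt_atTop 0] with k hk
    rw [← hcast _ hk]
    exact ENNReal.div_le_div_right (ENat.toENNReal_le.mpr (hup k)) _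

namespace ToricSemigroup

variable {d : ℕ} {Λ : ToricSemigroup d}

/-- The common form of the two limit formulas. `S` is the set of exponents of a germ, or of
generators of an ideal, and `a k` is the order of the `k`-th power: `hup` bounds it by means of
the monomial valuations of the `n_k`, and `hlow` says that it is at least `m` if `I ^ m` contains
the monomials with exponents in `k N(S)`. -/
theorem exists_limit_isLeast {I : Set Λ.Exp} (hI : I.Nonempty) (hI' : Λ.monomialIdeal I ≠ ⊤)
    (S : Set Λ.Exp) (a : ℕ → ℕ∞) (htop : S = ∅ → ∀ k : ℕ, k ≠ 0 → a k = ⊤)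
    (hup : ∀ n ∈ Λ.excVectors I, ∀ k m : ℕ, (m : ℕ∞) ≤ a k → ∀ r : ℝ,
      (∀ u ∈ I, r ≤ Exp.weight Λ (toReal n) u) → ∀ α ∈ S,
        m * r ≤ k * Exp.weight Λ (toReal n) α)
    (hlow : ∀ k m : ℕ, (∀ β : Λ.Exp, (∀ η ∈ Λ.cone, ∀ r : ℝ,
      (∀ α ∈ S, r ≤ Exp.weight Λ η α) → k * r ≤ Exp.weight Λ η β) →
        Λ.monomial β ∈ Λ.monomialIdeal I ^ m) → (m : ℕ∞) ≤ a k) :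
    ∃ c : ℝ≥0∞, Tendsto (fun k : ℕ => (a k : ℝ≥0∞) / (k : ℝ≥0∞)) atTop (𝓝 c) ∧
      IsLeast {q : EReal | ∃ n ∈ Λ.excVectors I,
        q = supportFn (Λ.newton S) (toReal n) / supportFn (Λ.newton I) (toReal n)} (c : EReal) := by
  classical
  obtain ⟨E, K, hE, hmem⟩ := exists_finset_excVectors hI
  have hEne : E.Nonempty := by
    by_contra hc
    rw [Finset.not_nonempty_iff_eq_empty] at hc
    have := hmem 0 ((1 : ℕ) + K) (by positivity) (by simp [hc]) 1 le_rfl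
    rw [pow_one, monomial_zero] at this
    exact hI' ((Ideal.eq_top_iff_one _).mpr this)
  -- the order of the ideal at the `n_k`; no condition is imposed on `o` elsewhere
  have hordI : ∀ n : Fin d → ℤ, ∃ o : ℝ, n ∈ Λ.excVectors I → 1 ≤ o ∧
      supportFn (Λ.newton I) (toReal n) = (o : EReal) ∧
      (∀ u ∈ I, o ≤ Exp.weight Λ (toReal n) u) ∧
      ∀ r : ℝ, (∀ u ∈ I, r ≤ Exp.weight Λ (toReal n) u) → r ≤ o := by
    intro n
    by_cases hn : n ∈ Λ.excVectors I
    · obtain ⟨u, hu, hmin⟩ := Exp.exists_weight_le (cone_of_mem_excVectors hn) hI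
      exact ⟨_, fun _ => ⟨one_le_weight_of_mem_excVectors hn hu,
        supportFn_newton (cone_of_mem_excVectors hn) hu hmin, hmin, fun r hr => hr u hu⟩⟩
    · exact ⟨0, fun h => absurd h hn⟩
  choose o ho using hordI
  rcases S.eq_empty_or_nonempty with hS | hS
  -- for the zero germ and the zero ideal all the quotients are infinite
  · have hq : ∀ n ∈ Λ.excVectors I,
        supportFn (Λ.newton S) (toReal n) / supportFn (Λ.newton I) (toReal n) = ⊤ := by
      intro n hn
      obtain ⟨h1, h2, -⟩ := ho n hn
      rw [hS, supportFn_newton_empty, h2]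
      exact EReal.top_div_of_pos_ne_top (EReal.coe_pos.mpr (by linarith)) (EReal.coe_ne_top _)
    refine ⟨⊤, tendsto_const_nhds.congr' ?_, ?_, ?_⟩
    · filter_upwards [eventually_ne_atTop 0] with k hk
      rw [htop hS k hk, ENat.toENNReal_top, ENNReal.top_div_of_ne_top (ENNReal.natCast_ne_top k)]
    · obtain ⟨n, hn⟩ := hEne
      exact ⟨n, hE hn, by rw [hq n (hE hn), EReal.coe_ennreal_top]⟩
    · rintro _ ⟨n, hn, rfl⟩
      rw [hq n hn]
      exact le_top
  · have hordS : ∀ n : Fin d → ℤ, ∃ w : ℝ, n ∈ Λ.excVectors I → 0 ≤ w ∧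
        supportFn (Λ.newton S) (toReal n) = (w : EReal) ∧
        (∀ α ∈ S, w ≤ Exp.weight Λ (toReal n) α) ∧
        ∃ α ∈ S, Exp.weight Λ (toReal n) α = w := by
      intro n
      by_cases hn : n ∈ Λ.excVectors I
      · obtain ⟨α, hα, hmin⟩ := Exp.exists_weight_le (cone_of_mem_excVectors hn) hS
        exact ⟨_, fun _ => ⟨mem_cone_iff.mp (cone_of_mem_excVectors hn) α,
          supportFn_newton (cone_of_mem_excVectors hn) hα hmin, hmin, α, hα, rfl⟩⟩
      · exact ⟨0, fun h => absurd h hn⟩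
    choose w hw using hordS
    obtain ⟨n₀, hn₀, hmin⟩ := E.exists_min_image (fun n => w n / o n) hEne
    set c := w n₀ / o n₀ with hc
    have hc0 : 0 ≤ c := div_nonneg (hw n₀ (hE hn₀)).1 (by linarith [(ho n₀ (hE hn₀)).1])
    have hle : ∀ n ∈ Λ.excVectors I, ∀ k m : ℕ, (m : ℕ∞) ≤ a k → (m : ℝ) ≤ w n / o n * k := by
      intro n hn k m hm
      obtain ⟨-, -, -, α, hα, hαw⟩ := hw n hn
      have h1 := hup n hn k m hm (o n) (ho n hn).2.2.1 α hα
      rw [hαw] at h1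
      have h2 : 0 < o n := by linarith [(ho n hn).1]
      rw [div_mul_eq_mul_div, le_div_iff₀ h2]
      linarith
    have hfloor : ∀ n ∈ Λ.excVectors I, ∀ k : ℕ, a k ≤ ((⌊w n / o n * k⌋₊ : ℕ) : ℕ∞) := by
      intro n hn k
      by_contra hlt
      push Not at hlt
      have h1 := hle n hn k (⌊w n / o n * k⌋₊ + 1) (by
        push_cast
        exact Order.add_one_le_of_lt hlt)
      push_cast at h1
      linarith [Nat.lt_floor_add_one (w n / o n * k)]
    have hge : ∀ k : ℕ, ((⌊c * k⌋₊ - K : ℕ) : ℕ∞) ≤ a k := by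
      intro k
      rcases le_or_gt ⌊c * k⌋₊ K with h | h
      · rw [Nat.sub_eq_zero_of_le h]
        exact zero_le
      · refine hlow k _ fun β hβ => hmem β (c * k) (by positivity) (fun n hn r hr => ?_) _ ?_
        · obtain ⟨-, -, h3, -⟩ := hw n (hE hn)
          have h4 := hβ (toReal n) (cone_of_mem_excVectors (hE hn)) (w n) h3
          have h5 : 0 < o n := by linarith [(ho n (hE hn)).1]
          have h6 : c * o n ≤ w n := (le_div_iff₀ h5).mp (hmin n hn)
          calc c * k * r ≤ c * k * o n :=
                mul_le_mul_of_nonneg_left ((ho n (hE hn)).2.2.2 r hr) (by positivity)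
            _ = k * (c * o n) := by ring
            _ ≤ k * w n := mul_le_mul_of_nonneg_left h6 (Nat.cast_nonneg k)
            _ ≤ _ := h4
        · rw [Nat.cast_sub h.le, sub_add_cancel]
          exact Nat.floor_le (by positivity)
    refine ⟨ENNReal.ofReal c, tendsto_div_of_floor_le hc0 K hge (hfloor n₀ (hE hn₀)),
      ⟨n₀, hE hn₀, ?_⟩, ?_⟩
    · rw [(hw n₀ (hE hn₀)).2.1, (ho n₀ (hE hn₀)).2.1, ← EReal.coe_div, EReal.coe_ennreal_ofReal,
        max_eq_left hc0]
    · rintro _ ⟨n, hn, rfl⟩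
      rw [(hw n hn).2.1, (ho n hn).2.1, ← EReal.coe_div, EReal.coe_ennreal_ofReal, max_eq_left hc0]
      refine EReal.coe_le_coe_iff.mpr ?_
      -- otherwise the order of a high power would exceed the bound given by `n`
      by_contra hlt
      push Not at hlt
      obtain ⟨k, hk⟩ := exists_nat_gt (((K : ℝ) + 1) / (c - w n / o n))
      rw [div_lt_iff₀ (by linarith)] at hk
      have h1 := hle n hn k _ (hge k)
      have h2 : (⌊c * k⌋₊ : ℝ) ≤ ((⌊c * k⌋₊ - K : ℕ) : ℝ) + K := by
        exact_mod_cast (by omega : ⌊c * k⌋₊ ≤ ⌊c * k⌋₊ - K + K)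
      linarith [Nat.lt_floor_add_one (c * k)]

theorem exists_limit_nuQuot {I : Set Λ.Exp}
    (hI : I.Nonempty) (hI' : Λ.monomialIdeal I ≠ ⊤) (φ : Λ.germs) :
    ∃ c : ℝ≥0∞, Tendsto (nuQuot (Λ.monomialIdeal I) φ) atTop (𝓝 c) ∧
      IsLeast {q : EReal | ∃ n ∈ Λ.excVectors I,
        q = supportFn (Λ.newtonGerm φ) (toReal n) / supportFn (Λ.newton I) (toReal n)}
        (c : EReal) := by
  refine exists_limit_isLeast hI hI' {α | (φ : HahnSeries Λ.Exp ℂ).coeff α ≠ 0}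
    (fun k => nu (Λ.monomialIdeal I) (φ ^ k)) (fun hS k hk => ?_)
    (fun n hn k m hm r hr α hα => ?_) fun k m h => ?_
  · have hφ : φ = 0 := Subtype.ext (HahnSeries.ext (funext fun α => by
      by_contra hc
      exact (Set.eq_empty_iff_forall_notMem.mp hS α) hc))
    refine ENat.eq_top_iff_forall_ge.mpr fun m => ?_
    rw [natCast_le_nu_iff, hφ, zero_pow hk]
    exact zero_mem _
  · rw [natCast_le_nu_iff] at hm
    have hcone := cone_of_mem_excVectors hn
    obtain ⟨β, hβ, hle⟩ := exists_coeff_pow_ne_zero hcone hα k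
    refine le_trans ?_ hle
    exact weightIdeal_pow_le hcone r m
      (Ideal.pow_right_mono (monomialIdeal_le_weightIdeal hcone hr) m hm) β hβ
  · rw [natCast_le_nu_iff]
    refine mem_of_monomial_mem _ _ fun β hβ => h β fun η hη r hr => ?_
    exact weightIdeal_pow_le hη r k (Ideal.pow_mem_pow ((mem_weightIdeal hη).mpr hr) k) β hβ

theorem exists_limit_nuIdealQuot {I : Set Λ.Exp}
    (hI : I.Nonempty) (hI' : Λ.monomialIdeal I ≠ ⊤) (J : Set Λ.Exp) :
    ∃ c : ℝ≥0∞, Tendsto (nuIdealQuot (Λ.monomialIdeal I) (Λ.monomialIdeal J)) atTop (𝓝 c) ∧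
      IsLeast {q : EReal | ∃ n ∈ Λ.excVectors I,
        q = supportFn (Λ.newton J) (toReal n) / supportFn (Λ.newton I) (toReal n)}
        (c : EReal) := by
  refine exists_limit_isLeast hI hI' J
    (fun k => nuIdeal (Λ.monomialIdeal I) (Λ.monomialIdeal J ^ k)) (fun hS k hk => ?_)
    (fun n hn k m hm r hr α hα => ?_) fun k m h => ?_
  · have hbot : Λ.monomialIdeal J = ⊥ := by
      rw [hS, monomialIdeal, Set.image_empty, Ideal.span_empty]
    refine ENat.eq_top_iff_forall_ge.mpr fun m => ?_
    rw [natCast_le_nuIdeal_iff, hbot, Ideal.bot_pow hk]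
    exact bot_le
  · rw [natCast_le_nuIdeal_iff] at hm
    have hcone := cone_of_mem_excVectors hn
    have hmem := monomial_sum_mem_pow (fun _ : Unit => α) (fun _ => hα) (fun _ => k)
    simp only [Finset.univ_unique, Finset.sum_singleton] at hmem
    have := weightIdeal_pow_le hcone r m
      (Ideal.pow_right_mono (monomialIdeal_le_weightIdeal hcone hr) m (hm hmem)) (k • α)
      (by rw [monomial_coeff_self]; exact one_ne_zero)
    rwa [map_nsmul, nsmul_eq_mul] at this
  · rw [natCast_le_nuIdeal_iff]
    refine fun f hf => mem_of_monomial_mem _ _ fun β hβ => h β fun η hη r hr => ?_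
    exact weightIdeal_pow_le hη r k
      (Ideal.pow_right_mono (monomialIdeal_le_weightIdeal hη hr) k hf) β hβ

end ToricSemigroup

end AsymptoticOrder

theorem mainTheorem10 {d : ℕ} (Λ : ToricSemigroup d) (I J : Set Λ.Exp)
    (hI : I.Nonempty) (hI' : Λ.monomialIdeal I ≠ ⊤) (hJ : Λ.monomialIdeal J ≠ ⊤)
    (φ : Λ.germs) :
    (Tendsto (nuQuot (Λ.monomialIdeal I) φ) atTop (𝓝 (nuBar (Λ.monomialIdeal I) φ)) ∧
      IsLeast
        {q : EReal | ∃ n ∈ Λ.excVectors I,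
          q = supportFn (Λ.newtonGerm φ) (toReal n) / supportFn (Λ.newton I) (toReal n)}
        (nuBar (Λ.monomialIdeal I) φ : EReal)) ∧
    (Tendsto (nuIdealQuot (Λ.monomialIdeal I) (Λ.monomialIdeal J)) atTop
        (𝓝 (nuBarIdeal (Λ.monomialIdeal I) (Λ.monomialIdeal J))) ∧
      IsLeast
        {q : EReal | ∃ n ∈ Λ.excVectors I,
          q = supportFn (Λ.newton J) (toReal n) / supportFn (Λ.newton I) (toReal n)}
        (nuBarIdeal (Λ.monomialIdeal I) (Λ.monomialIdeal J) : EReal)) := by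

  obtain ⟨c, hc, hleast⟩ := ToricSemigroup.exists_limit_nuQuot hI hI' φ
  obtain ⟨c', hc', hleast'⟩ := ToricSemigroup.exists_limit_nuIdealQuot hI hI' J
  have h : nuBar (Λ.monomialIdeal I) φ = c := hc.limUnder_eq
  have h' : nuBarIdeal (Λ.monomialIdeal I) (Λ.monomialIdeal J) = c' := hc'.limUnder_eq
  rw [h, h']
  exact ⟨⟨hc, hleast⟩, hc', hleast'⟩
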